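/- Let $X$ be a locally compact Polish space and let $\sigma$ be a Radon measure on $X$ (a Borel measure that is finite on compact sets) with $\sigma(\{x\})=0$ for all $x\in X$. Write $\mathbb R_+=(0,\infty)$. Let $\mathbb K(X)$ be the set of discrete Radon measures on $X$, i.e. of the Radon measures $\eta=\sum_i s_i\delta_{x_i}$ with at most countably many distinct atoms $x_i\in X$ and weights $s_i>0$ (the zero measure included), with the trace of the Borel $\sigma$-algebra of the vague topology. Let $C_0(X\to\mathbb R_+)$ be the group of continuous functions $\theta:X\to\mathbb R_+$ that equal $1$ outside a compact set. It acts on $\mathbb K(X)$ by $\eta\mapsto\theta\eta$, where $\theta\eta$ has density $\theta$ with respect to $\eta$; for a probability measure $\mu$ on $\mathbb K(X)$, let $\mu^\theta$ be its push-forward under $\eta\mapsto\theta\eta$. Let $\alpha:X\to\mathbb R_+$ and $\beta:X\to[0,\infty)$ be measurable functions such that $\alpha\beta$ and $\beta$ are locally integrable with respect to $\sigma$. Put $Y=\{x\in X:\beta(x)>0\}$ and $$dm(x,s)=\frac{\beta(x)e^{-s/\alpha(x)}}{s}\,d\sigma(x)\,ds\quad\text{on } X\times\mathbb R_+ .$$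 **Theorem.** There is exactly one probability measure $\mu_m$ on $\mathbb K(X)$ that is completely random (the random variables $\eta(A_1),\dots,\eta(A_n)$ are independent for any mutually disjoint relatively compact Borel sets $A_1,\dots,A_n$) and has the Fourier transform $$\int_{\mathbb K(X)}e^{i\int_X f\,d\eta}\,d\mu_m(\eta)=\exp\left[\int_{X\times\mathbb R_+}\left(e^{isf(x)}-1\right)dm(x,s)\right]$$ for all continuous $f:X\to\mathbb R$ with compact support. The measure $\mu_m$ is quasi-invariant under $C_0(X\to\mathbb R_+)$: for each $\theta\in C_0(X\to\mathbb R_+)$, the measures $\mu_m^\theta$ and $\mu_m$ are equivalent. Moreover, for each such $\theta$, the function $x\mapsto(1-\theta(x)^{-1})\alpha(x)^{-1}$ is in $L^1(Y,\eta)$ for $\mu_m$-a.a. $\eta$, the function $\beta\log\theta$ is in $L^1(Y,\sigma)$, and, for $\mu_m$-a.a. $\eta\in\mathbb K(X)$, $$\frac{d\mu_m^\theta}{d\mu_m}(\eta)=\exp\left[\int_Y\left(1-\theta(x)^{-1}\right)\frac1{\alpha(x)}\,d\eta(x)-\int_Y\log(\theta(x))\,\beta(x)\,d\sigma(x)\right].$$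 -/

import Mathlib

open MeasureTheory ProbabilityTheory Set Filter
open scoped ENNReal NNReal

noncomputable section

/-- A measure `η` is a discrete Radon measure if it is finite on compact sets and of the form
`∑ s_i δ_{x_i}` with at most countably many distinct atoms `x_i` (the elements of `S`) and
weights `s_i ∈ (0, ∞)`. The empty sum, the zero measure, is allowed. -/
def IsDiscreteRadon {X : Type*} [TopologicalSpace X] [MeasurableSpace X] (η : Measure X) : Prop :=
  (∀ Λ : Set X, IsCompact Λ → η Λ < ∞) ∧
    ∃ S : Set X, S.Countable ∧ ∃ s : X → ℝ≥0, (∀ x ∈ S, 0 < s x) ∧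
      η = Measure.sum (fun x : S => s (x : X) • Measure.dirac (x : X))

/-- The cone `𝕂(X)` of discrete Radon measures on `X`. Its σ-algebra is the trace of the σ-algebra
on `Measure X` generated by the evaluations `η ↦ η A`. On a locally compact Polish space this is
the σ-algebra generated by the evaluations at relatively compact Borel sets (every Borel set is an
increasing union of such sets), that is, the Borel σ-algebra of the vague topology. -/
abbrev DiscreteRadon (X : Type*) [TopologicalSpace X] [MeasurableSpace X] : Type _ :=
  {η : Measure X // IsDiscreteRadon η}

/-- The elements of the current group `C₀(X → ℝ₊)`: continuous functions `θ : X → (0, ∞)` which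
are equal to `1` outside a compact set. -/
structure Current (X : Type*) [TopologicalSpace X] where
  toFun : X → ℝ
  continuous_toFun : Continuous toFun
  pos : ∀ x, 0 < toFun x
  eq_one : ∃ C : Set X, IsCompact C ∧ ∀ x ∉ C, toFun x = 1

namespace Current

variable {X : Type*} [TopologicalSpace X] [MeasurableSpace X]

/-- The measure `θ η`, which has density `θ` with respect to `η`. -/
def mulMeasure (θ : Current X) (η : Measure X) : Measure X :=
  η.withDensity (fun x => ENNReal.ofReal (θ.toFun x))

/-- The action of currents maps discrete Radon measures to discrete Radon measures. -/
theorem isDiscreteRadon_mulMeasure [BorelSpace X] (θ : Current X) {η : Measure X}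
    (h : IsDiscreteRadon η) : IsDiscreteRadon (θ.mulMeasure η) := by
  have hm : Measurable (fun x => ENNReal.ofReal (θ.toFun x)) :=
    θ.continuous_toFun.measurable.ennreal_ofReal
  obtain ⟨hfin, S, hS, s, hs, rfl⟩ := h
  refine ⟨fun Λ hΛ => ?_, S, hS, fun x => s x * (θ.toFun x).toNNReal,
    fun x hx => mul_pos (hs x hx) (Real.toNNReal_pos.2 (θ.pos x)), ?_⟩
  · obtain ⟨B, hB⟩ := (hΛ.image θ.continuous_toFun).bddAbove
    have hfΛ := hfin Λ hΛ
    set η := Measure.sum (fun x : S => s (x : X) • Measure.dirac (x : X))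
    have : SFinite η := by
      have : Countable S := hS.to_subtype
      infer_instance
    calc θ.mulMeasure η Λ = ∫⁻ x in Λ, ENNReal.ofReal (θ.toFun x) ∂η :=
          withDensity_apply' _ _
      _ ≤ ∫⁻ x in Λ, ENNReal.ofReal B ∂η :=
          setLIntegral_mono measurable_const fun x hx =>
            ENNReal.ofReal_le_ofReal (hB (mem_image_of_mem _ hx))
      _ < ∞ := by
          rw [setLIntegral_const]
          exact ENNReal.mul_lt_top ENNReal.ofReal_lt_top hfΛ
  · rw [mulMeasure, withDensity_sum]
    congr 1
    funext x
    ext A hA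
    rw [withDensity_apply _ hA, ← lintegral_indicator hA, lintegral_smul_measure,
      lintegral_dirac' _ (hm.indicator hA)]
    by_cases hx : (x : X) ∈ A
    · simp [hx, Measure.dirac_apply' _ hA, ENNReal.smul_def, ENNReal.ofReal]
    · simp [hx, Measure.dirac_apply' _ hA]

/-- The action `η ↦ θ η` of currents on `𝕂(X)`. -/
def act [BorelSpace X] (θ : Current X) (η : DiscreteRadon X) : DiscreteRadon X :=
  ⟨θ.mulMeasure η.1, θ.isDiscreteRadon_mulMeasure η.2⟩

/-- The action is measurable, so that push-forwards under it are the genuine ones. -/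
theorem measurable_act [BorelSpace X] (θ : Current X) : Measurable θ.act := by
  have hm : Measurable (fun x => ENNReal.ofReal (θ.toFun x)) :=
    θ.continuous_toFun.measurable.ennreal_ofReal
  refine Measurable.subtype_mk (Measure.measurable_of_measurable_coe _ fun A hA => ?_)
  have : (fun η : DiscreteRadon X => θ.mulMeasure η.1 A) = fun η : DiscreteRadon X =>
      ∫⁻ x, A.indicator (fun x => ENNReal.ofReal (θ.toFun x)) x ∂η.1 := by
    funext η
    rw [mulMeasure, withDensity_apply _ hA, lintegral_indicator hA]
  rw [this]
  exact (Measure.measurable_lintegral (hm.indicator hA)).comp measurable_subtype_coe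

end Current

/-- A probability measure `μ` on `𝕂(X)` is quasi-invariant under `C₀(X → ℝ₊)` if for every current
`θ` the push-forward of `μ` under `η ↦ θ η` is equivalent to `μ`. -/
def IsQuasiInvariant {X : Type*} [TopologicalSpace X] [MeasurableSpace X] [BorelSpace X]
    (μ : Measure (DiscreteRadon X)) : Prop :=
  ∀ θ : Current X, μ.map θ.act ≪ μ ∧ μ ≪ μ.map θ.act

/-- The (distribution `μ` of a) random discrete measure is completely random: its values at
mutually disjoint relatively compact Borel sets are independent. -/
def IsCompletelyRandom {X : Type*} [TopologicalSpace X] [MeasurableSpace X]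
    (μ : Measure (DiscreteRadon X)) : Prop :=
  ∀ (n : ℕ) (A : Fin n → Set X), (∀ i, MeasurableSet (A i)) → (∀ i, IsCompact (closure (A i))) →
    Pairwise (fun i j => Disjoint (A i) (A j)) →
    iIndepFun (fun i (η : DiscreteRadon X) => η.1 (A i)) μ

/-- `μ` is (the distribution of) a completely random discrete measure with Lévy measure `m`, i.e.
with Fourier transform `E exp(i⟨f, η⟩) = exp (∫ (exp(i s f(x)) - 1) dm(x, s))`, `f ∈ C₀(X)`.
Here `m` is a measure on `X × (0, ∞)`, regarded as a measure on `X × ℝ`. -/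
structure IsCompletelyRandomWithLevy {X : Type*} [TopologicalSpace X] [MeasurableSpace X]
    (m : Measure (X × ℝ)) (μ : Measure (DiscreteRadon X)) : Prop where
  isProbability : IsProbabilityMeasure μ
  completelyRandom : IsCompletelyRandom μ
  fourier : ∀ f : X → ℝ, Continuous f → HasCompactSupport f →
    ∫ η : DiscreteRadon X, Complex.exp (Complex.I * ((∫ x, f x ∂η.1 : ℝ) : ℂ)) ∂μ =
      Complex.exp (∫ p : X × ℝ, (Complex.exp (Complex.I * ((p.2 * f p.1 : ℝ) : ℂ)) - 1) ∂m)

/-- The measure `dm(x, s) = (β(x) exp(-s / α(x)) / s) dσ(x) ds` on `X × (0, ∞)`. -/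
def gammaLevyMeasure {X : Type*} [MeasurableSpace X] (σ : Measure X) (α β : X → ℝ) :
    Measure (X × ℝ) :=
  (σ.prod (volume.restrict (Ioi (0 : ℝ)))).withDensity
    (fun p => ENNReal.ofReal (β p.1 * Real.exp (-p.2 / α p.1) / p.2))

end

-- Let `N` be a Poisson process on `X × ℝ₊` with intensity `m`, and put `η = ∑ s δ_x` over the
-- points `(x, s)` of `N`. Since `m` is infinite near `s = 0` wherever `β > 0`, `N` is built as a
-- superposition of independent finite Poisson samples whose intensities sum to `m`. Campbell's
-- formula gives `E ∫ φ dη = ∫ s φ(x) dm = ∫ α β φ dσ`, so `η` is almost surely finite on compact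
-- sets.
--
-- Everything else rests on the exponential functional (`integral_exp_superposition`) `E exp ⟨w, η⟩
-- = exp ∫ (e^{s w(x)} - 1) dm`, valid for complex `w` when `s w` is integrable and the positive
-- part of its real part has exponential moments. For `w = i f` it is the required Fourier
-- transform. The exponent is additive over functions with disjoint supports, which gives complete
-- randomness. Uniqueness holds because the Fourier transform determines the finite-dimensional laws
-- of `(⟨f, η⟩)_f`, and these integrals generate the σ-algebra (`ext_of_fourier`).
--
-- For quasi-invariance take `w = i f + g` with `g = (1 - θ⁻¹)/α` on `Y`. The factor `e^{s g}` turns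
-- the fibre density `e^{-s/α}/s` into `e^{-s/(θα)}/s`, which is the image of the former under `s ↦
-- θ s`, because `ds/s` is scale invariant. The change of normalisation is the Frullani integral `∫
-- (e^{-s/(θα)} - e^{-s/α}) ds/s = log θ` (`integral_gamma_tilt`). Hence `exp(⟨g, η⟩ - ∫ β log θ dσ)
-- dμ` has the Fourier transform of the law of `θ η`, and uniqueness identifies the two measures
-- (`map_act_eq_withDensity`). The density is strictly positive, so the measures are equivalent.

noncomputable section

-- Finite Poisson samples.

section PoissonSample

variable {E : Type*} [MeasurableSpace E]

theorem measurable_of_measurable_comp_sigmaMk {ι : Type*} {β : ι → Type*} {γ : Type*}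
    [∀ i, MeasurableSpace (β i)] [MeasurableSpace γ] {f : (Σ i, β i) → γ}
    (hf : ∀ i, Measurable fun x => f ⟨i, x⟩) : Measurable f := by
  intro s hs
  rw [Sigma.instMeasurableSpace, MeasurableSpace.measurableSet_iInf]
  exact fun i => hf i hs

theorem measurable_sigmaMk {ι : Type*} {β : ι → Type*} [∀ i, MeasurableSpace (β i)] (i : ι) :
    Measurable (Sigma.mk i : β i → Σ i, β i) := by
  intro s hs
  rw [Sigma.instMeasurableSpace, MeasurableSpace.measurableSet_iInf] at hs
  exact hs i

/-- The law of a finite Poisson sample with intensity measure `m`: the number `k` of points is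
Poisson distributed and, given `k`, the points are independent with law proportional to `m`. -/
def poissonSample (m : Measure E) : Measure (Σ k : ℕ, Fin k → E) :=
  Measure.sum fun k => ENNReal.ofReal (Real.exp (-m.real univ) / k.factorial) •
    (Measure.pi fun _ : Fin k => m).map (Sigma.mk k)

theorem measurable_sample_prod {h : E → ℂ} (hh : Measurable h) :
    Measurable fun ω : Σ k : ℕ, Fin k → E => ∏ i, h (ω.2 i) :=
  measurable_of_measurable_comp_sigmaMk fun k => by
    change Measurable fun x : Fin k → E => ∏ i : Fin k, h (x i)
    fun_prop

theorem measurable_sample_sum {M : Type*} [AddCommMonoid M] [MeasurableSpace M] [MeasurableAdd₂ M]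
    {h : E → M} (hh : Measurable h) :
    Measurable fun ω : Σ k : ℕ, Fin k → E => ∑ i, h (ω.2 i) :=
  measurable_of_measurable_comp_sigmaMk fun k => by
    change Measurable fun x : Fin k → E => ∑ i : Fin k, h (x i)
    fun_prop

/-- By Fubini the samples with `k` points contribute `e^{-m(E)} (∫ h dm)^k / k!`, and these terms
form an exponential series. The case `h = 1` shows that the total mass is one. -/
theorem poissonSample_prod {m : Measure E} [IsFiniteMeasure m] {h : E → ℂ} (hh : Measurable h)
    (hi : Integrable h m) :
    Integrable (fun ω : Σ k : ℕ, Fin k → E => ∏ i, h (ω.2 i)) (poissonSample m) ∧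
      ∫ ω, ∏ i, h (ω.2 i) ∂(poissonSample m) = Complex.exp (∫ x, (h x - 1) ∂m) := by
  have hmp := measurable_sample_prod hh
  have hpi : ∀ k : ℕ, Integrable (fun x : Fin k → E => ∏ i, h (x i))
      (Measure.pi fun _ : Fin k => m) := fun k => Integrable.fintype_prod fun _ => hi
  have hint : Integrable (fun ω : Σ k : ℕ, Fin k → E => ∏ i, h (ω.2 i)) (poissonSample m) := by
    refine integrable_sum_measure (fun k => ?_) ?_
    · refine Integrable.smul_measure ?_ ENNReal.ofReal_ne_top
      rw [integrable_map_measure hmp.aestronglyMeasurable (measurable_sigmaMk k).aemeasurable]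
      exact hpi k
    · have : ∀ k : ℕ, ∫ ω : Σ k : ℕ, Fin k → E, ‖∏ i, h (ω.2 i)‖ ∂(ENNReal.ofReal (Real.exp (-m.real univ) / k.factorial) •
          (Measure.pi fun _ : Fin k => m).map (Sigma.mk k)) =
          Real.exp (-m.real univ) * ((∫ x, ‖h x‖ ∂m) ^ k / k.factorial) := by
        intro k
        rw [integral_smul_measure, integral_map (measurable_sigmaMk k).aemeasurable
          hmp.norm.aestronglyMeasurable, ENNReal.toReal_ofReal (by positivity)]
        simp_rw [norm_prod]
        rw [integral_fintype_prod_eq_pow (fun x => ‖h x‖), Fintype.card_fin, smul_eq_mul]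
        ring
      simp_rw [this]
      exact (Real.summable_pow_div_factorial _).mul_left _
  refine ⟨hint, ?_⟩
  have h1 := hasSum_integral_measure hint
  have h2 : ∀ k : ℕ, ∫ ω : Σ k : ℕ, Fin k → E, ∏ i, h (ω.2 i) ∂(ENNReal.ofReal (Real.exp (-m.real univ) / k.factorial) •
      (Measure.pi fun _ : Fin k => m).map (Sigma.mk k)) =
      Complex.exp (-m.real univ) * ((∫ x, h x ∂m) ^ k / k.factorial) := by
    intro k
    rw [integral_smul_measure, integral_map (measurable_sigmaMk k).aemeasurable
      hmp.aestronglyMeasurable, ENNReal.toReal_ofReal (by positivity)]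
    simp only
    rw [integral_fintype_prod_eq_pow h, Fintype.card_fin, Complex.real_smul]
    push_cast
    ring
  simp_rw [h2] at h1
  rw [poissonSample, h1.unique ((NormedSpace.expSeries_div_hasSum_exp (∫ x, h x ∂m)).mul_left _),
    ← Complex.exp_eq_exp_ℂ, ← Complex.exp_add, integral_sub hi (integrable_const _)]
  congr 1
  simp
  ring

instance isProbabilityMeasure_poissonSample (m : Measure E) [IsFiniteMeasure m] :
    IsProbabilityMeasure (poissonSample m) := by
  have h := poissonSample_prod (m := m) (h := fun _ => 1) measurable_const (integrable_const _)
  simp only [Finset.prod_const_one, sub_self, integral_zero, Complex.exp_zero] at h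
  have : IsFiniteMeasure (poissonSample m) := by
    simpa [integrable_const_iff] using h.1
  have h2 := h.2
  rw [integral_const] at h2
  refine ⟨?_⟩
  have h3 : (poissonSample m).real univ = 1 := by simpa using h2
  rwa [measureReal_def, ENNReal.toReal_eq_one_iff] at h3

/-- The `k` coordinates contribute equally; the factor `k` cancels against `k!` and shifts the
exponential series by one. -/
theorem lintegral_poissonSample_sum {m : Measure E} [IsFiniteMeasure m] {φ : E → ℝ≥0∞}
    (hφ : Measurable φ) :
    ∫⁻ ω, ∑ i, φ (ω.2 i) ∂(poissonSample m) = ∫⁻ x, φ x ∂m := by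
  rw [poissonSample, lintegral_sum_measure]
  have h1 : ∀ k : ℕ, ∫⁻ ω : Σ k : ℕ, Fin k → E, ∑ i, φ (ω.2 i) ∂(ENNReal.ofReal (Real.exp (-m.real univ) / k.factorial) •
      (Measure.pi fun _ : Fin k => m).map (Sigma.mk k)) =
      ENNReal.ofReal (Real.exp (-m.real univ) / k.factorial) *
        (k * (m univ ^ (k - 1) * ∫⁻ x, φ x ∂m)) := by
    intro k
    rw [lintegral_smul_measure, lintegral_map (measurable_sample_sum hφ) (measurable_sigmaMk k),
      smul_eq_mul]
    congr 1
    change ∫⁻ x : Fin k → E, ∑ i : Fin k, φ (x i) ∂(Measure.pi fun _ : Fin k => m) = _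
    rw [lintegral_finsetSum _ (fun i _ => by fun_prop)]
    have : ∀ i : Fin k, ∫⁻ x : Fin k → E, φ (x i) ∂(Measure.pi fun _ : Fin k => m) =
        m univ ^ (k - 1) * ∫⁻ x, φ x ∂m := by
      intro i
      have := lintegral_map (μ := Measure.pi fun _ : Fin k => m) hφ (measurable_pi_apply i)
      rw [← this]
      have e := Measure.pi_map_eval (fun _ : Fin k => m) i
      rw [show (fun x : Fin k → E => x i) = Function.eval i from rfl, e]
      rw [lintegral_smul_measure]
      simp
    simp only [this]
    simp
  simp_rw [h1]
  rw [tsum_eq_zero_add' ENNReal.summable]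
  simp only [CharP.cast_eq_zero, zero_mul, mul_zero, zero_add, Nat.add_sub_cancel]
  have h2 : ∀ k : ℕ, ENNReal.ofReal (Real.exp (-m.real univ) / (k + 1).factorial) *
        (((k + 1 : ℕ) : ℝ≥0∞) * (m univ ^ k * ∫⁻ x, φ x ∂m)) =
      ENNReal.ofReal (Real.exp (-m.real univ) * ((m.real univ) ^ k / k.factorial)) *
        ∫⁻ x, φ x ∂m := by
    intro k
    have : m univ = ENNReal.ofReal (m.real univ) := by simp
    rw [this, ← ENNReal.ofReal_pow (by positivity), ← ENNReal.ofReal_natCast, ← mul_assoc,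
      ← mul_assoc, ← ENNReal.ofReal_mul (by positivity), ← ENNReal.ofReal_mul (by positivity)]
    congr 2
    rw [Nat.factorial_succ]
    push_cast
    field_simp
  simp_rw [h2]
  rw [ENNReal.tsum_mul_right, ← ENNReal.ofReal_tsum_of_nonneg (fun k => by positivity)
    ((Real.summable_pow_div_factorial _).mul_left _), tsum_mul_left]
  have := (NormedSpace.expSeries_div_hasSum_exp (m.real univ)).tsum_eq
  rw [this, ← Real.exp_eq_exp_ℝ, ← Real.exp_add]
  simp

end PoissonSample

-- Poisson processes with s-finite intensity: Campbell's formula and exponential functional.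

section PoissonProcess

variable {E : Type*} [MeasurableSpace E]

/-- The point measure of a finite sample. -/
def samplePoints (ω : Σ k : ℕ, Fin k → E) : Measure E :=
  ∑ i, Measure.dirac (ω.2 i)

/-- The superposition of a sequence of finite samples. -/
def superposition (ω : ℕ → Σ k : ℕ, Fin k → E) : Measure E :=
  Measure.sum fun n => samplePoints (ω n)

/-- The law of a sequence of independent finite Poisson samples whose intensities sum up
to `m`. -/
def poissonSequence (m : Measure E) [SFinite m] : Measure (ℕ → Σ k : ℕ, Fin k → E) :=
  Measure.infinitePi fun n => poissonSample (sfiniteSeq m n)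

instance (m : Measure E) [SFinite m] : IsProbabilityMeasure (poissonSequence m) := by
  unfold poissonSequence; infer_instance

theorem lintegral_samplePoints (ω : Σ k : ℕ, Fin k → E) {φ : E → ℝ≥0∞} (hφ : Measurable φ) :
    ∫⁻ x, φ x ∂(samplePoints ω) = ∑ i, φ (ω.2 i) := by
  rw [samplePoints, lintegral_finsetSum_measure]
  simp [lintegral_dirac' _ hφ]

theorem integral_samplePoints (ω : Σ k : ℕ, Fin k → E) {φ : E → ℂ} (hφ : Measurable φ) :
    ∫ x, φ x ∂(samplePoints ω) = ∑ i, φ (ω.2 i) := by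
  rw [samplePoints, integral_finsetSum_measure]
  · simp [integral_dirac' _ _ hφ.stronglyMeasurable]
  · exact fun i _ => (integrable_dirac' hφ.stronglyMeasurable (by simp))

theorem superposition_eq_sum_dirac (ω : ℕ → Σ k : ℕ, Fin k → E) :
    superposition ω = Measure.sum fun p : Σ n : ℕ, Fin (ω n).1 => Measure.dirac ((ω p.1).2 p.2) := by
  ext A hA
  rw [superposition, Measure.sum_apply _ hA, Measure.sum_apply _ hA, ENNReal.tsum_sigma']
  congr 1
  funext n
  rw [samplePoints, Measure.finsetSum_apply, tsum_fintype]

theorem measurable_superposition :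
    Measurable (superposition : (ℕ → Σ k : ℕ, Fin k → E) → Measure E) := by
  refine Measure.measurable_of_measurable_coe _ fun A hA => ?_
  simp_rw [superposition, Measure.sum_apply _ hA]
  refine Measurable.tsum fun n => ?_
  suffices h : Measurable fun ω : Σ k : ℕ, Fin k → E => samplePoints ω A from
    h.comp (measurable_pi_apply n)
  have := measurable_sample_sum (E := E) (h := A.indicator (1 : E → ℝ≥0∞))
    (measurable_one.indicator hA)
  convert this with ω
  rw [← lintegral_samplePoints _ (measurable_one.indicator hA), lintegral_indicator_one hA]

variable (m : Measure E) [SFinite m]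

/-- Campbell's formula. -/
theorem lintegral_lintegral_superposition {φ : E → ℝ≥0∞} (hφ : Measurable φ) :
    ∫⁻ ω, ∫⁻ x, φ x ∂(superposition ω) ∂(poissonSequence m) = ∫⁻ x, φ x ∂m := by
  simp_rw [superposition, lintegral_sum_measure, lintegral_samplePoints _ hφ]
  have hm := measurable_sample_sum hφ
  have hm' : ∀ n : ℕ, Measurable fun ω : ℕ → Σ k : ℕ, Fin k → E => ∑ i, φ ((ω n).2 i) :=
    fun n => hm.comp (measurable_pi_apply n)
  rw [lintegral_tsum fun n => (hm' n).aemeasurable]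
  conv_rhs => rw [← sum_sfiniteSeq m, lintegral_sum_measure]
  congr 1
  funext n
  rw [← lintegral_poissonSample_sum hφ,
    ← Measure.infinitePi_map_eval (fun n => poissonSample (sfiniteSeq m n)) n,
    lintegral_map hm (measurable_pi_apply n)]
  rfl

/-- The samples are independent, so the expectation of the product factorises into exponential
functionals of single samples. -/
theorem integral_exp_partial_superposition {φ : E → ℂ} (hφ : Measurable φ)
    (hi : Integrable (fun x => Complex.exp (φ x) - 1) m) (n : ℕ) :
    ∫ ω, Complex.exp (∑ k ∈ Finset.range n, ∑ i, φ ((ω k).2 i)) ∂(poissonSequence m) =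
      Complex.exp (∑ k ∈ Finset.range n, ∫ x, (Complex.exp (φ x) - 1) ∂(sfiniteSeq m k)) := by
  have hE : Measurable fun x => Complex.exp (φ x) := by fun_prop
  have hind : iIndepFun (fun k ω => ∏ i, Complex.exp (φ ((ω k).2 i))) (poissonSequence m) :=
    iIndepFun_infinitePi (P := fun n => poissonSample (sfiniteSeq m n))
      (X := fun _ ω => ∏ i, Complex.exp (φ (ω.2 i))) fun _ => measurable_sample_prod hE
  have hind' := hind.precomp (g := fun i : Finset.range n => (i : ℕ)) Subtype.val_injective
  have h := hind'.integral_fun_prod_eq_prod_integral fun k =>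
    ((measurable_sample_prod hE).comp (measurable_pi_apply (k : ℕ))).aestronglyMeasurable
  simp_rw [Complex.exp_sum]
  rw [← Finset.prod_coe_sort]
  simp_rw [← Finset.prod_coe_sort (Finset.range n)]
  rw [h]
  refine Finset.prod_congr rfl fun k _ => ?_
  have hk : Integrable (fun x => Complex.exp (φ x)) (sfiniteSeq m k) := by
    have := (hi.mono_measure (sfiniteSeq_le m k)).add (integrable_const (1 : ℂ))
    exact this.congr (ae_of_all _ fun x => by simp)
  rw [← (poissonSample_prod hE hk).2,
    ← Measure.infinitePi_map_eval (fun n => poissonSample (sfiniteSeq m n)) k,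
    integral_map (measurable_pi_apply _).aemeasurable
      (measurable_sample_prod hE).aestronglyMeasurable]
  rfl

/-- Splitting `e^z` into modulus and phase shows that the phase and a negative real part cost only a
linear term; exponential integrability is needed for the positive part of `z.re` alone. -/
theorem norm_exp_sub_one_le_of_max (z : ℂ) :
    ‖Complex.exp z - 1‖ ≤ 2 * ‖z‖ + (Real.exp (max z.re 0) - 1) := by
  have h1 : Complex.exp z - 1 = (Complex.exp z.re - 1) * Complex.exp (Complex.I * z.im) +
      (Complex.exp (Complex.I * z.im) - 1) := by
    conv_lhs => rw [← Complex.re_add_im z, Complex.exp_add, mul_comm (z.im : ℂ)]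
    ring
  have h2 : ‖(Complex.exp z.re - 1) * Complex.exp (Complex.I * z.im)‖ = |Real.exp z.re - 1| := by
    rw [norm_mul, mul_comm Complex.I, Complex.norm_exp_ofReal_mul_I, mul_one, ← Complex.ofReal_exp,
      ← Complex.ofReal_one, ← Complex.ofReal_sub, Complex.norm_real, Real.norm_eq_abs]
  have h3 : |Real.exp z.re - 1| ≤ |z.re| + (Real.exp (max z.re 0) - 1) := by
    rcases le_total 0 z.re with h | h
    · rw [max_eq_left h, abs_of_nonneg (by simpa using h)]
      linarith [abs_nonneg z.re]
    · rw [max_eq_right h, abs_of_nonpos (by simpa using h), abs_of_nonpos h]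
      simp only [Real.exp_zero]
      linarith [Real.add_one_le_exp z.re]
  have h4 := Real.norm_exp_I_mul_ofReal_sub_one_le (x := z.im)
  have h5 := Complex.abs_re_le_norm z
  have h6 := Complex.abs_im_le_norm z
  rw [h1]
  refine (norm_add_le _ _).trans ?_
  rw [h2]
  rw [Real.norm_eq_abs] at h4
  linarith

theorem integrable_exp_sub_one {m : Measure E} {φ : E → ℂ} (hφ : Integrable φ m)
    (hφ' : Integrable (fun x => Real.exp (max (φ x).re 0) - 1) m) :
    Integrable (fun x => Complex.exp (φ x) - 1) m := by
  refine ((hφ.norm.const_mul 2).add hφ').mono' ?_ (ae_of_all _ fun x => ?_)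
  · exact (Complex.continuous_exp.comp_aestronglyMeasurable hφ.1).sub aestronglyMeasurable_const
  · exact norm_exp_sub_one_le_of_max (φ x)

theorem ae_integrable_superposition {F : Type*} [NormedAddCommGroup F] [MeasurableSpace F]
    [OpensMeasurableSpace F] [SecondCountableTopology F] {φ : E → F} (hφ : Measurable φ)
    (hi : Integrable φ m) :
    ∀ᵐ ω ∂(poissonSequence m), Integrable φ (superposition ω) := by
  have h := lintegral_lintegral_superposition m hφ.enorm
  have h2 := ae_lt_top ((Measure.measurable_lintegral hφ.enorm).comp measurable_superposition)
    (h.trans_lt hi.2).ne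
  filter_upwards [h2] with ω hω
  exact ⟨hφ.aestronglyMeasurable, hω⟩

/-- The exponential functional of a Poisson process. -/
theorem integral_exp_superposition {φ : E → ℂ} (hφ : Measurable φ) (hi : Integrable φ m)
    (hi' : Integrable (fun x => Real.exp (max (φ x).re 0) - 1) m) :
    Integrable (fun ω => Complex.exp (∫ x, φ x ∂(superposition ω))) (poissonSequence m) ∧
    ∫ ω, Complex.exp (∫ x, φ x ∂(superposition ω)) ∂(poissonSequence m) =
      Complex.exp (∫ x, (Complex.exp (φ x) - 1) ∂m) := by
  have hpartial : ∀ {χ : E → ℂ}, Measurable χ → ∀ n, Measurable fun ω : ℕ → Σ k : ℕ, Fin k → E =>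
      ∑ k ∈ Finset.range n, ∑ i, χ ((ω k).2 i) := fun hχ n =>
    Finset.measurable_fun_sum _ fun k _ => (measurable_sample_sum hχ).comp (measurable_pi_apply k)
  have hlim : ∀ {χ : E → ℂ}, Measurable χ → Integrable χ m → ∀ᵐ ω ∂(poissonSequence m),
      HasSum (fun k => ∑ i, χ ((ω k).2 i)) (∫ x, χ x ∂(superposition ω)) := by
    intro χ hχ hχi
    filter_upwards [ae_integrable_superposition m hχ hχi] with ω hω
    have := hasSum_integral_measure hω
    simp only [integral_samplePoints _ hχ] at this
    exact this
  have hexp : ∀ {χ : E → ℂ}, Integrable (fun x => Complex.exp (χ x) - 1) m →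
      Tendsto (fun n => Complex.exp (∑ k ∈ Finset.range n,
        ∫ x, (Complex.exp (χ x) - 1) ∂(sfiniteSeq m k))) atTop
        (nhds (Complex.exp (∫ x, (Complex.exp (χ x) - 1) ∂m))) := by
    intro χ hχ
    have h := hχ
    rw [← sum_sfiniteSeq m] at h
    have h2 := (hasSum_integral_measure h).tendsto_sum_nat
    rw [sum_sfiniteSeq m] at h2
    exact (Complex.continuous_exp.tendsto _).comp h2
  -- The partial sums of `ψ ≥ 0` increase, so the exponential `D` of the full sum dominates the
  -- exponentials of all partial sums of `φ`. Fatou's lemma makes `D` integrable, and dominated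
  -- convergence then gives the formula.
  set ψ : E → ℝ := fun x => max (φ x).re 0 with hψ
  have hψm : Measurable ψ := (Complex.measurable_re.comp hφ).max measurable_const
  have hψi : Integrable ψ m := hi.re.pos_part
  have hψc : Integrable (fun x => (ψ x : ℂ)) m := hψi.ofReal
  have hψcm : Measurable fun x => (ψ x : ℂ) := Complex.measurable_ofReal.comp hψm
  have hψ0 : ∀ x, 0 ≤ ψ x := fun x => le_max_right _ _
  have hψe : Integrable (fun x => Complex.exp (ψ x) - 1) m := by
    refine hi'.ofReal.congr (ae_of_all _ fun x => ?_)
    simp [hψ]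
  set S : ℕ → (ℕ → Σ k : ℕ, Fin k → E) → ℝ :=
    fun n ω => ∑ k ∈ Finset.range n, ∑ i, ψ ((ω k).2 i) with hS
  have hSm : ∀ n, Measurable (S n) := fun n =>
    Finset.measurable_fun_sum _ fun k _ => (measurable_sample_sum hψm).comp (measurable_pi_apply k)
  set D : (ℕ → Σ k : ℕ, Fin k → E) → ℝ := fun ω => Real.exp (∫ x, ψ x ∂(superposition ω)) with hD
  have hψsum : ∀ᵐ ω ∂(poissonSequence m),
      HasSum (fun k => ∑ i, ψ ((ω k).2 i)) (∫ x, ψ x ∂(superposition ω)) := by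
    filter_upwards [hlim hψcm hψc] with ω hω
    rw [integral_complex_ofReal] at hω
    exact_mod_cast hω
  have hSint : ∀ n, ∫⁻ ω, ENNReal.ofReal (Real.exp (S n ω)) ∂(poissonSequence m) =
      ENNReal.ofReal (Complex.exp (∑ k ∈ Finset.range n,
        ∫ x, (Complex.exp (ψ x) - 1) ∂(sfiniteSeq m k))).re := by
    intro n
    have h := integral_exp_partial_superposition m hψcm hψe n
    have h1 : ∀ ω, Complex.exp (∑ k ∈ Finset.range n, ∑ i, (ψ ((ω k).2 i) : ℂ)) =
        ((Real.exp (S n ω) : ℝ) : ℂ) := by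
      intro ω
      simp [hS]
    simp_rw [h1] at h
    have hint : Integrable (fun ω => Real.exp (S n ω)) (poissonSequence m) := by
      -- The Bochner integral of a non-integrable function is zero, whereas here it equals an
      -- exponential.
      by_contra hcon
      rw [integral_complex_ofReal, integral_undef hcon] at h
      exact Complex.exp_ne_zero _ (h.symm.trans Complex.ofReal_zero)
    rw [← ofReal_integral_eq_lintegral_ofReal hint (ae_of_all _ fun _ => (Real.exp_pos _).le), ← h,
      integral_complex_ofReal, Complex.ofReal_re]
  have hDm : AEStronglyMeasurable D (poissonSequence m) := by
    refine aestronglyMeasurable_of_tendsto_ae atTop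
      (fun n => (Real.measurable_exp.comp (hSm n)).aestronglyMeasurable) ?_
    filter_upwards [hψsum] with ω hω
    exact (Real.continuous_exp.tendsto _).comp hω.tendsto_sum_nat
  have hDi : Integrable D (poissonSequence m) := by
    refine ⟨hDm, ?_⟩
    have h1 : ∀ᵐ ω ∂(poissonSequence m), ‖D ω‖ₑ =
        liminf (fun n => ENNReal.ofReal (Real.exp (S n ω))) atTop := by
      filter_upwards [hψsum] with ω hω
      rw [Real.enorm_of_nonneg (Real.exp_pos _).le]
      exact (((ENNReal.continuous_ofReal.comp Real.continuous_exp).tendsto _).comp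
        hω.tendsto_sum_nat).liminf_eq.symm
    have h2 : ∀ n, Measurable fun ω => ENNReal.ofReal (Real.exp (S n ω)) := fun n =>
      (Real.measurable_exp.comp (hSm n)).ennreal_ofReal
    rw [HasFiniteIntegral, lintegral_congr_ae h1]
    refine (lintegral_liminf_le h2).trans_lt ?_
    simp_rw [hSint]
    exact ((((ENNReal.continuous_ofReal.comp Complex.continuous_re).tendsto _).comp
      (hexp hψe)).liminf_eq).trans_lt ENNReal.ofReal_lt_top
  have hbound : ∀ n, ∀ᵐ ω ∂(poissonSequence m),
      ‖Complex.exp (∑ k ∈ Finset.range n, ∑ i, φ ((ω k).2 i))‖ ≤ D ω := by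
    intro n
    filter_upwards [hψsum] with ω hω
    rw [Complex.norm_exp]
    refine Real.exp_le_exp.2 (le_trans ?_ (sum_le_hasSum (Finset.range n)
      (fun k _ => Finset.sum_nonneg fun i _ => hψ0 _) hω))
    rw [Complex.re_sum]
    refine Finset.sum_le_sum fun k _ => ?_
    rw [Complex.re_sum]
    exact Finset.sum_le_sum fun i _ => le_max_left _ _
  have hconv : ∀ᵐ ω ∂(poissonSequence m),
      Tendsto (fun n => Complex.exp (∑ k ∈ Finset.range n, ∑ i, φ ((ω k).2 i))) atTop
        (nhds (Complex.exp (∫ x, φ x ∂(superposition ω)))) := by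
    filter_upwards [hlim hφ hi] with ω hω
    exact (Complex.continuous_exp.tendsto _).comp hω.tendsto_sum_nat
  have hmeas : ∀ n, AEStronglyMeasurable (fun ω : ℕ → Σ k : ℕ, Fin k → E =>
      Complex.exp (∑ k ∈ Finset.range n, ∑ i, φ ((ω k).2 i))) (poissonSequence m) := fun n =>
    (Complex.measurable_exp.comp (hpartial hφ n)).aestronglyMeasurable
  refine ⟨hDi.mono' (aestronglyMeasurable_of_tendsto_ae atTop hmeas hconv) ?_, ?_⟩
  · filter_upwards [hconv, ae_all_iff.2 hbound] with ω h1 h2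
    exact le_of_tendsto' h1.norm h2
  · have h1 := tendsto_integral_of_dominated_convergence D hmeas hDi hbound hconv
    simp_rw [integral_exp_partial_superposition m hφ (integrable_exp_sub_one hi hi')] at h1
    exact tendsto_nhds_unique h1 (hexp (integrable_exp_sub_one hi hi'))

end PoissonProcess

-- Discrete Radon measures from marked points.

section DiscreteRadonMeasures

variable {X : Type*} [TopologicalSpace X] [MeasurableSpace X]

/-- A countable sum of weighted Dirac measures which is finite on compact sets is a discrete Radon
measure. -/
theorem isDiscreteRadon_sum_smul_dirac [T1Space X] [BorelSpace X] {ι : Type*}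
    [Countable ι] (c : ι → ℝ≥0) (x : ι → X)
    (h : ∀ Λ : Set X, IsCompact Λ → Measure.sum (fun i => c i • Measure.dirac (x i)) Λ < ∞) :
    IsDiscreteRadon (Measure.sum fun i => c i • Measure.dirac (x i)) := by
  set η := Measure.sum fun i => c i • Measure.dirac (x i) with hη
  -- The points `x i` may coincide and the weights may vanish, so the distinct atoms are recovered
  -- as the points of positive mass.
  refine ⟨h, {y | η {y} ≠ 0}, ?_, fun y => (η {y}).toNNReal, ?_, ?_⟩
  · refine (countable_range x).mono fun y hy => ?_
    by_contra hcon
    refine hy ?_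
    rw [hη, Measure.sum_apply _ (measurableSet_singleton y), ENNReal.tsum_eq_zero]
    intro i
    have : x i ∉ ({y} : Set X) := fun e => hcon ⟨i, e⟩
    simp [Measure.dirac_apply' _ (measurableSet_singleton y), this]
  · exact fun y hy => ENNReal.toNNReal_pos hy (h {y} isCompact_singleton).ne
  · have hc : {y | η {y} ≠ 0} ⊆ range x := by
      intro y hy
      by_contra hcon
      refine hy ?_
      rw [hη, Measure.sum_apply _ (measurableSet_singleton y), ENNReal.tsum_eq_zero]
      intro i
      have : x i ∉ ({y} : Set X) := fun e => hcon ⟨i, e⟩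
      simp [Measure.dirac_apply' _ (measurableSet_singleton y), this]
    have hcount : {y | η {y} ≠ 0}.Countable := (countable_range x).mono hc
    have hnull : η ({y | η {y} ≠ 0}ᶜ) = 0 := by
      rw [hη, Measure.sum_apply _ (hcount.measurableSet.compl), ENNReal.tsum_eq_zero]
      intro i
      rw [Measure.smul_apply, Measure.dirac_apply' _ hcount.measurableSet.compl]
      by_cases hi : c i = 0
      · simp [hi]
      · have : x i ∉ {y | η {y} ≠ 0}ᶜ := by
          simp only [mem_compl_iff, mem_ofPred_eq, not_not]
          intro h0
          rw [hη, Measure.sum_apply _ (measurableSet_singleton _), ENNReal.tsum_eq_zero] at h0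
          have := h0 i
          rw [Measure.smul_apply, Measure.dirac_apply_of_mem (mem_singleton _), ENNReal.smul_def,
            smul_eq_mul, mul_one, ENNReal.coe_eq_zero] at this
          exact hi this
        simp [this]
    have : Countable {y | η {y} ≠ 0} := hcount.to_subtype
    ext A hA
    refine Eq.trans ?_ (Measure.sum_apply _ hA).symm
    have h1 : η A = η (A ∩ {y | η {y} ≠ 0}) := by
      refine le_antisymm ?_ (measure_mono inter_subset_left)
      calc η A ≤ η (A ∩ {y | η {y} ≠ 0}) + η (A \ {y | η {y} ≠ 0}) := by
            rw [measure_inter_add_sdiff _ hcount.measurableSet]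
        _ ≤ η (A ∩ {y | η {y} ≠ 0}) + 0 := by
            gcongr
            exact (measure_mono fun y hy => hy.2).trans hnull.le
        _ = _ := add_zero _
    have h2 : A ∩ {y | η {y} ≠ 0} = ⋃ y : {y | η {y} ≠ 0}, A ∩ {(y : X)} := by
      ext y; simp [and_comm]
    rw [h1, h2, measure_iUnion]
    · refine tsum_congr fun y => ?_
      rw [Measure.smul_apply, Measure.dirac_apply' _ hA, ENNReal.smul_def,
        ENNReal.coe_toNNReal (h {(y : X)} isCompact_singleton).ne, smul_eq_mul]
      by_cases hy : (y : X) ∈ A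
      · simp [hy, inter_eq_right.2 (singleton_subset_iff.2 hy)]
      · simp [hy]
    · intro y z hyz
      refine Disjoint.mono inter_subset_right inter_subset_right ?_
      simpa [disjoint_singleton] using fun e => hyz (Subtype.ext e)
    · exact fun y => hA.inter (measurableSet_singleton _)

/-- The measure with atoms `s` at `x` when the point measure `N` has an atom at `(x, s)`. -/
def markMeasure (N : Measure (X × ℝ)) : Measure X :=
  (N.withDensity fun p => ENNReal.ofReal p.2).map Prod.fst

omit [TopologicalSpace X] in
theorem lintegral_markMeasure (N : Measure (X × ℝ)) {φ : X → ℝ≥0∞} (hφ : Measurable φ) :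
    ∫⁻ x, φ x ∂(markMeasure N) = ∫⁻ p, ENNReal.ofReal p.2 * φ p.1 ∂N := by
  rw [markMeasure, lintegral_map hφ measurable_fst, lintegral_withDensity_eq_lintegral_mul _
    (by fun_prop) (by fun_prop)]
  rfl

omit [TopologicalSpace X] in
theorem measurable_markMeasure : Measurable (markMeasure : Measure (X × ℝ) → Measure X) := by
  refine Measure.measurable_of_measurable_coe _ fun A hA => ?_
  have : ∀ N : Measure (X × ℝ), markMeasure N A =
      ∫⁻ p, ENNReal.ofReal p.2 * A.indicator 1 p.1 ∂N := fun N => by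
    rw [← lintegral_markMeasure N (measurable_one.indicator hA), lintegral_indicator_one hA]
  simp_rw [this]
  have hA' : Measurable (A.indicator (1 : X → ℝ≥0∞)) := measurable_one.indicator hA
  exact Measure.measurable_lintegral (by fun_prop)

omit [TopologicalSpace X] in
theorem markMeasure_sum_dirac {ι : Type*} (p : ι → X × ℝ) :
    markMeasure (Measure.sum fun i => Measure.dirac (p i)) =
      Measure.sum fun i => (p i).2.toNNReal • Measure.dirac (p i).1 := by
  ext A hA
  have hA' : Measurable (A.indicator (1 : X → ℝ≥0∞)) := measurable_one.indicator hA
  rw [← lintegral_indicator_one hA, lintegral_markMeasure _ hA', lintegral_sum_measure,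
    Measure.sum_apply _ hA]
  refine tsum_congr fun i => ?_
  rw [lintegral_dirac' _ (by fun_prop), Measure.smul_apply, Measure.dirac_apply' _ hA,
    ENNReal.smul_def, ENNReal.ofReal, smul_eq_mul]

omit [TopologicalSpace X] in
-- Nonnegative marks are needed because `ENNReal.ofReal` truncates negative ones to zero.
theorem integral_markMeasure (N : Measure (X × ℝ)) (hN : ∀ᵐ p ∂N, 0 ≤ p.2) {w : X → ℂ}
    (hw : Measurable w) :
    ∫ x, w x ∂(markMeasure N) = ∫ p, p.2 * w p.1 ∂N := by
  rw [markMeasure, integral_map measurable_fst.aemeasurable hw.aestronglyMeasurable,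
    integral_withDensity_eq_integral_toReal_smul (by fun_prop) (ae_of_all _ fun _ => by simp)]
  refine integral_congr_ae ?_
  filter_upwards [hN] with p hp
  simp [ENNReal.toReal_ofReal hp]

end DiscreteRadonMeasures

-- Existence of the compound Poisson measure.

section Existence

variable {X : Type*} [TopologicalSpace X] [MeasurableSpace X]

theorem isDiscreteRadon_zero : IsDiscreteRadon (0 : Measure X) := by
  refine ⟨by simp, ∅, countable_empty, fun _ => 0, by simp, ?_⟩
  ext A hA
  simp

theorem stronglyMeasurable_integral_discreteRadon {F : Type*} [NormedAddCommGroup F]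
    [NormedSpace ℝ F] {f : X → F} (hf : StronglyMeasurable f) :
    StronglyMeasurable fun η : DiscreteRadon X => ∫ x, f x ∂η.1 :=
  hf.integral_kernel (κ := ⟨Subtype.val, measurable_subtype_coe⟩)

/-- A compound Poisson random measure: for a measure `m` on `X × (0, ∞)` with locally integrable
first moment in the second variable, there is a random discrete Radon measure whose intensity and
exponential functional are given by `m`. -/
theorem exists_compoundPoisson [T2Space X] [BorelSpace X] [WeaklyLocallyCompactSpace X]
    [SigmaCompactSpace X] (m : Measure (X × ℝ)) [SFinite m] (hm : ∀ᵐ p ∂m, 0 ≤ p.2)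
    (hloc : ∀ K : Set X, IsCompact K → ∫⁻ p, ENNReal.ofReal p.2 * K.indicator 1 p.1 ∂m < ∞) :
    ∃ μ : Measure (DiscreteRadon X), IsProbabilityMeasure μ ∧
      (∀ φ : X → ℝ≥0∞, Measurable φ →
        ∫⁻ η : DiscreteRadon X, ∫⁻ x, φ x ∂η.1 ∂μ = ∫⁻ p, ENNReal.ofReal p.2 * φ p.1 ∂m) ∧
      (∀ w : X → ℂ, Measurable w → Integrable (fun p : X × ℝ => p.2 * w p.1) m →
        Integrable (fun p : X × ℝ => Real.exp (max (p.2 * (w p.1).re) 0) - 1) m →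
        Integrable (fun η : DiscreteRadon X => Complex.exp (∫ x, w x ∂η.1)) μ ∧
        ∫ η : DiscreteRadon X, Complex.exp (∫ x, w x ∂η.1) ∂μ =
          Complex.exp (∫ p, (Complex.exp (p.2 * w p.1) - 1) ∂m)) := by
  set T : (ℕ → Σ k : ℕ, Fin k → X × ℝ) → Measure X := fun ω => markMeasure (superposition ω) with hT
  have hTm : Measurable T := measurable_markMeasure.comp measurable_superposition
  have hcamp : ∀ φ : X → ℝ≥0∞, Measurable φ →
      ∫⁻ ω, ∫⁻ x, φ x ∂(T ω) ∂(poissonSequence m) = ∫⁻ p, ENNReal.ofReal p.2 * φ p.1 ∂m := by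
    intro φ hφ
    simp_rw [hT, lintegral_markMeasure _ hφ]
    exact lintegral_lintegral_superposition m (by fun_prop)
  let K : CompactExhaustion X := default
  -- On `G` the marked measure is finite on an exhaustion, hence on every compact set. Outside this
  -- almost sure event it is replaced by the zero measure, so that all values lie in the cone.
  set G : Set (ℕ → Σ k : ℕ, Fin k → X × ℝ) := ⋂ n, {ω | T ω (K n) < ∞} with hG
  have hGm : MeasurableSet G := MeasurableSet.iInter fun n => measurableSet_lt
    ((Measure.measurable_coe (K.isCompact n).measurableSet).comp hTm) measurable_const
  have hGae : ∀ᵐ ω ∂(poissonSequence m), ω ∈ G := by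
    have h : ∀ n, ∀ᵐ ω ∂(poissonSequence m), T ω (K n) < ∞ := by
      intro n
      refine ae_lt_top ((Measure.measurable_coe (K.isCompact n).measurableSet).comp hTm) ?_
      have h := hcamp ((K n).indicator 1)
        (measurable_one.indicator (K.isCompact n).measurableSet)
      simp_rw [lintegral_indicator_one (K.isCompact n).measurableSet] at h
      rw [h]
      exact (hloc _ (K.isCompact n)).ne
    filter_upwards [ae_all_iff.2 h] with ω hω
    exact mem_iInter.2 hω
  have hrad : ∀ ω ∈ G, IsDiscreteRadon (T ω) := by
    intro ω hω
    have e : T ω = Measure.sum fun p : Σ n : ℕ, Fin (ω n).1 =>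
        ((ω p.1).2 p.2).2.toNNReal • Measure.dirac ((ω p.1).2 p.2).1 := by
      rw [hT]
      simp only
      rw [superposition_eq_sum_dirac, markMeasure_sum_dirac]
    have hfin : ∀ Λ : Set X, IsCompact Λ → T ω Λ < ∞ := by
      intro Λ hΛ
      obtain ⟨n, hn⟩ := K.exists_superset_of_isCompact hΛ
      exact (measure_mono hn).trans_lt (mem_iInter.1 hω n)
    rw [e] at hfin ⊢
    exact isDiscreteRadon_sum_smul_dirac _ _ hfin
  set V := G.indicator T with hV
  have hVm : Measurable V := hTm.indicator hGm
  have hVrad : ∀ ω, IsDiscreteRadon (V ω) := by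
    intro ω
    by_cases hω : ω ∈ G
    · rw [hV, indicator_of_mem hω]; exact hrad ω hω
    · rw [hV, indicator_of_notMem hω]; exact isDiscreteRadon_zero
  have hVT : ∀ᵐ ω ∂(poissonSequence m), V ω = T ω := by
    filter_upwards [hGae] with ω hω
    exact indicator_of_mem hω _
  set H : (ℕ → Σ k : ℕ, Fin k → X × ℝ) → DiscreteRadon X := fun ω => ⟨V ω, hVrad ω⟩ with hH
  have hHm : Measurable H := hVm.subtype_mk
  -- Campbell's formula for the set of negative marks, which is `m`-null.
  have hposN : ∀ᵐ ω ∂(poissonSequence m), ∀ᵐ p ∂(superposition ω), 0 ≤ p.2 := by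
    have hs : MeasurableSet {p : X × ℝ | ¬ 0 ≤ p.2} :=
      (measurableSet_le measurable_const measurable_snd).compl
    have h := lintegral_lintegral_superposition m (measurable_one.indicator hs)
    simp_rw [lintegral_indicator_one hs] at h
    rw [show m {p : X × ℝ | ¬ 0 ≤ p.2} = 0 from hm] at h
    have hsm : Measurable fun ω : ℕ → Σ k : ℕ, Fin k → X × ℝ =>
        superposition ω {p : X × ℝ | ¬ 0 ≤ p.2} :=
      (Measure.measurable_coe hs).comp measurable_superposition
    rwa [lintegral_eq_zero_iff hsm] at h
  refine ⟨(poissonSequence m).map H, Measure.isProbabilityMeasure_map hHm.aemeasurable,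
    fun φ hφ => ?_, fun w hw h1 h2 => ?_⟩
  · have hφm : Measurable fun η : DiscreteRadon X => ∫⁻ x, φ x ∂η.1 :=
      (Measure.measurable_lintegral hφ).comp measurable_subtype_coe
    rw [lintegral_map hφm hHm, ← hcamp φ hφ]
    refine lintegral_congr_ae ?_
    filter_upwards [hVT] with ω hω
    simp only [hH, hω]
  · have h3 := integral_exp_superposition m (φ := fun p => p.2 * w p.1) (by fun_prop) h1
      (by simpa using h2)
    have hwm : StronglyMeasurable fun η : DiscreteRadon X => Complex.exp (∫ x, w x ∂η.1) :=
      Complex.continuous_exp.comp_stronglyMeasurable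
        (stronglyMeasurable_integral_discreteRadon hw.stronglyMeasurable)
    have hae : (fun ω => Complex.exp (∫ p, p.2 * w p.1 ∂(superposition ω)))
        =ᵐ[poissonSequence m] fun ω => Complex.exp (∫ x, w x ∂(H ω).1) := by
      filter_upwards [hVT, hposN] with ω hω hp
      simp only [hH, hω]
      rw [hT]
      simp only
      rw [integral_markMeasure _ hp hw]
    rw [integrable_map_measure hwm.aestronglyMeasurable hHm.aemeasurable,
      integral_map hHm.aemeasurable hwm.aestronglyMeasurable]
    exact ⟨h3.1.congr hae, by rw [← h3.2]; exact (integral_congr_ae hae).symm⟩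

end Existence

-- Uniqueness from the Fourier transform.

section Uniqueness

variable {X : Type*} [TopologicalSpace X] [MeasurableSpace X]

theorem IsDiscreteRadon.isFiniteMeasureOnCompacts {η : Measure X} (h : IsDiscreteRadon η) :
    IsFiniteMeasureOnCompacts η :=
  ⟨fun _ hK => h.1 _ hK⟩

instance (η : DiscreteRadon X) : IsFiniteMeasureOnCompacts η.1 :=
  η.2.isFiniteMeasureOnCompacts

variable [T2Space X] [LocallyCompactSpace X] [SigmaCompactSpace X]
  [TopologicalSpace.PseudoMetrizableSpace X] [BorelSpace X]

/-- A family of Radon measures depends measurably on a parameter if the integrals of all continuous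
functions with compact support do. -/
theorem measurable_of_measurable_integral {Ω : Type*} [MeasurableSpace Ω] {κ : Ω → Measure X}
    (hκ : ∀ ω, IsFiniteMeasureOnCompacts (κ ω))
    (h : ∀ f : X → ℝ, Continuous f → HasCompactSupport f → Measurable fun ω => ∫ x, f x ∂(κ ω)) :
    Measurable κ := by
  have hcomp : ∀ K : Set X, IsCompact K → Measurable fun ω => κ ω K := by
    intro K hK
    obtain ⟨f, hfK, -, hfc, hf01⟩ := exists_continuous_one_zero_of_isCompact_of_isGδ hK
      hK.isClosed.isGδ isClosed_empty (disjoint_empty K)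
    -- Since `f` takes values in `[0, 1]` and equals `1` exactly on `K`, its powers decrease to the
    -- indicator of `K`. The exponent `n + 1` avoids `f ^ 0 = 1`, which need not have compact
    -- support.
    have hpc : ∀ n : ℕ, HasCompactSupport fun x => f x ^ (n + 1) := fun n =>
      hfc.mono fun x hx hx' => hx (by simp [hx'])
    have hlim : ∀ ω, Tendsto (fun n : ℕ => ∫ x, f x ^ (n + 1) ∂(κ ω)) atTop
        (nhds (∫ x, K.indicator 1 x ∂(κ ω))) := by
      intro ω
      have := hκ ω
      refine tendsto_integral_of_dominated_convergence (fun x => f x)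
        (fun n => (f.continuous.pow _).measurable.aestronglyMeasurable)
        (f.continuous.integrable_of_hasCompactSupport hfc) (fun n => ae_of_all _ fun x => ?_)
        (ae_of_all _ fun x => ?_)
      · rw [Real.norm_of_nonneg (pow_nonneg (hf01 x).1 _)]
        exact pow_le_of_le_one (hf01 x).1 (hf01 x).2 (Nat.succ_ne_zero n)
      · by_cases hx : x ∈ K
        · have h1 : f x = 1 := by rw [hfK] at hx; exact hx
          simp [h1, hx]
        · have h1 : f x ≠ 1 := by rw [hfK] at hx; exact hx
          rw [indicator_of_notMem hx]
          exact (tendsto_pow_atTop_nhds_zero_of_lt_one (hf01 x).1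
            (lt_of_le_of_ne (hf01 x).2 h1)).comp (tendsto_add_atTop_nat 1)
    have hm : Measurable fun ω => ∫ x, K.indicator (1 : X → ℝ) x ∂(κ ω) :=
      measurable_of_tendsto_metrizable
        (fun n => h _ (f.continuous.pow (n + 1)) (hpc n)) (tendsto_pi_nhds.2 hlim)
    have he : (fun ω => κ ω K) =
        fun ω => ENNReal.ofReal (∫ x, K.indicator (1 : X → ℝ) x ∂(κ ω)) := by
      funext ω
      have := hκ ω
      rw [integral_indicator_one hK.measurableSet, ofReal_measureReal hK.measure_lt_top.ne]
    rw [he]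
    exact hm.ennreal_ofReal
  let C : CompactExhaustion X := default
  have hfin : ∀ n ω, IsFiniteMeasure ((κ ω).restrict (C n)) := fun n ω => by
    have := hκ ω
    exact ⟨by simpa using (C.isCompact n).measure_lt_top⟩
  -- The π-system argument on closed sets requires finite measures, hence the restriction to compact
  -- sets.
  have hres : ∀ n, Measurable fun ω => (κ ω).restrict (C n) := by
    intro n
    have := hfin n
    refine Measurable.measure_of_isPiSystem (S := {s | IsClosed s}) ?_ isPiSystem_isClosed ?_ ?_
    · rw [BorelSpace.measurable_eq (α := X), borel_eq_generateFrom_isClosed]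
    · intro s hs
      have hs : IsClosed s := hs
      simp_rw [Measure.restrict_apply hs.measurableSet]
      exact hcomp _ ((C.isCompact n).inter_left hs)
    · simp only [Measure.restrict_apply MeasurableSet.univ, univ_inter]
      exact hcomp _ (C.isCompact n)
  refine Measure.measurable_of_measurable_coe _ fun A hA => ?_
  have hsup : (fun ω => κ ω A) = fun ω => ⨆ n, (κ ω).restrict (C n) A := by
    funext ω
    simp_rw [Measure.restrict_apply hA]
    rw [← Monotone.measure_iUnion, ← inter_iUnion, C.iUnion_eq, inter_univ]
    exact fun i j hij => inter_subset_inter_right _ (C.subset hij)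
  rw [hsup]
  exact Measurable.iSup fun n => (Measure.measurable_coe hA).comp (hres n)

omit [T2Space X] [LocallyCompactSpace X] [SigmaCompactSpace X] [MeasurableSpace X]
  [TopologicalSpace.PseudoMetrizableSpace X] [BorelSpace X] in
theorem hasCompactSupport_sum {ι : Type*} (s : Finset ι) {f : ι → X → ℝ}
    (hf : ∀ i ∈ s, HasCompactSupport (f i)) : HasCompactSupport fun x => ∑ i ∈ s, f i x := by
  classical
  induction s using Finset.induction_on with
  | empty =>
    simp only [Finset.sum_empty]
    exact HasCompactSupport.zero
  | insert a s ha ih =>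
    simp_rw [Finset.sum_insert ha]
    exact (hf a (Finset.mem_insert_self a s)).add
      (ih fun i hi => hf i (Finset.mem_insert_of_mem hi))

/-- A finite measure on the cone of discrete Radon measures is determined by its Fourier
transform. -/
theorem ext_of_fourier {μ ν : Measure (DiscreteRadon X)} [IsFiniteMeasure μ] [IsFiniteMeasure ν]
    (h : ∀ f : X → ℝ, Continuous f → HasCompactSupport f →
      ∫ η : DiscreteRadon X, Complex.exp (Complex.I * ((∫ x, f x ∂η.1 : ℝ) : ℂ)) ∂μ =
      ∫ η : DiscreteRadon X, Complex.exp (Complex.I * ((∫ x, f x ∂η.1 : ℝ) : ℂ)) ∂ν) :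
    μ = ν := by
  let J := {f : X → ℝ // Continuous f ∧ HasCompactSupport f}
  let T : DiscreteRadon X → J → ℝ := fun η f => ∫ x, f.1 x ∂η.1
  have hTf : ∀ f : J, Measurable fun η : DiscreteRadon X => ∫ x, f.1 x ∂η.1 := fun f =>
    (stronglyMeasurable_integral_discreteRadon f.2.1.measurable.stronglyMeasurable).measurable
  have hT : Measurable T := measurable_pi_lambda _ hTf
  -- A linear combination of test functions is again a test function, so the hypothesis gives the
  -- joint characteristic functions.
  have hfd : ∀ I : Finset J, (μ.map T).map I.restrict = (ν.map T).map I.restrict := by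
    intro I
    refine (MeasurableEquiv.toLp 2 (I → ℝ)).map_measurableEquiv_injective
      <| Measure.ext_of_charFun <| funext fun t ↦ ?_
    have hr : Measurable (I.restrict : (J → ℝ) → I → ℝ) := by fun_prop
    have hP : Measurable (MeasurableEquiv.toLp 2 (I → ℝ)) :=
      (MeasurableEquiv.toLp 2 (I → ℝ)).measurable
    have hc : ∀ ρ : Measure (DiscreteRadon X),
        charFun (((ρ.map T).map I.restrict).map (MeasurableEquiv.toLp 2 (I → ℝ))) t =
        ∫ η : DiscreteRadon X, Complex.exp (Complex.I *
          ((∫ x, (∑ i : I, t i * i.1.1 x) ∂η.1 : ℝ) : ℂ)) ∂ρ := by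
      intro ρ
      rw [Measure.map_map hr hT, Measure.map_map hP (hr.comp hT), charFun_apply,
        integral_map (hP.comp (hr.comp hT)).aemeasurable (by fun_prop)]
      refine integral_congr_ae (ae_of_all _ fun η => ?_)
      simp only
      rw [mul_comm Complex.I, integral_finsetSum _ fun i _ =>
        (i.1.2.1.integrable_of_hasCompactSupport i.1.2.2).const_mul _]
      simp_rw [integral_const_mul]
      rw [PiLp.inner_apply]
      rfl
    rw [hc, hc]
    have hcont : Continuous fun x => ∑ i : I, t i * i.1.1 x :=
      continuous_finsetSum _ fun i _ => continuous_const.mul i.1.2.1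
    exact h _ hcont (hasCompactSupport_sum _ fun i _ => i.1.2.2.mul_left)
  have hmap : μ.map T = ν.map T :=
    IsProjectiveLimit.unique (P := fun I => (ν.map T).map I.restrict) hfd fun I => rfl
  -- The integrals of test functions generate the whole σ-algebra, so equality of the image laws
  -- suffices.
  have hle : (inferInstance : MeasurableSpace (DiscreteRadon X)) ≤
      MeasurableSpace.comap T inferInstance := by
    have hval : @Measurable _ _ (MeasurableSpace.comap T inferInstance) _
        (Subtype.val : DiscreteRadon X → Measure X) := by
      refine @measurable_of_measurable_integral X _ _ _ _ _ _ _ _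
        (MeasurableSpace.comap T inferInstance) _ (fun η => inferInstance) fun f hf hfc => ?_
      exact (measurable_pi_apply (⟨f, hf, hfc⟩ : J)).comp (comap_measurable T)
    exact hval.comap_le
  ext A hA
  obtain ⟨B, hB, rfl⟩ := hle A hA
  rw [← Measure.map_apply hT hB, ← Measure.map_apply hT hB, hmap]

end Uniqueness

-- Fourier transform and complete randomness of compound Poisson measures.

section CompleteRandomness

variable {X : Type*} [TopologicalSpace X] [MeasurableSpace X]

/-- The first moment of `m` in its second variable is locally finite, and `m` is carried by
`X × [0, ∞)`. -/
structure HasLocallyFiniteMean (m : Measure (X × ℝ)) : Prop where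
  ae_nonneg : ∀ᵐ p ∂m, 0 ≤ p.2
  lintegral_lt_top : ∀ K : Set X, IsCompact K →
    ∫⁻ p, ENNReal.ofReal p.2 * K.indicator 1 p.1 ∂m < ∞

/-- `μ` is the law of the random discrete measure obtained from a Poisson process with intensity
`m`; this is expressed by Campbell's formula and the exponential functional. -/
structure IsCompoundPoisson (m : Measure (X × ℝ)) (μ : Measure (DiscreteRadon X)) : Prop where
  isProbability : IsProbabilityMeasure μ
  campbell : ∀ φ : X → ℝ≥0∞, Measurable φ →
    ∫⁻ η : DiscreteRadon X, ∫⁻ x, φ x ∂η.1 ∂μ = ∫⁻ p, ENNReal.ofReal p.2 * φ p.1 ∂m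
  exp_functional : ∀ w : X → ℂ, Measurable w → Integrable (fun p : X × ℝ => p.2 * w p.1) m →
    Integrable (fun p : X × ℝ => Real.exp (max (p.2 * (w p.1).re) 0) - 1) m →
    Integrable (fun η : DiscreteRadon X => Complex.exp (∫ x, w x ∂η.1)) μ ∧
    ∫ η : DiscreteRadon X, Complex.exp (∫ x, w x ∂η.1) ∂μ =
      Complex.exp (∫ p, (Complex.exp (p.2 * w p.1) - 1) ∂m)

theorem exists_isCompoundPoisson [T2Space X] [BorelSpace X] [WeaklyLocallyCompactSpace X]
    [SigmaCompactSpace X] {m : Measure (X × ℝ)} [SFinite m] (hm : HasLocallyFiniteMean m) :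
    ∃ μ : Measure (DiscreteRadon X), IsCompoundPoisson m μ :=
  let ⟨μ, h1, h2, h3⟩ := exists_compoundPoisson m hm.ae_nonneg hm.lintegral_lt_top
  ⟨μ, h1, h2, h3⟩

omit [TopologicalSpace X] in
theorem integrable_snd_mul_of_lintegral_lt_top {m : Measure (X × ℝ)} (hm : ∀ᵐ p ∂m, 0 ≤ p.2)
    {w : X → ℂ} (hw : Measurable w) (h : ∫⁻ p, ENNReal.ofReal p.2 * ‖w p.1‖ₑ ∂m < ∞) :
    Integrable (fun p : X × ℝ => p.2 * w p.1) m := by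
  refine ⟨by fun_prop, ?_⟩
  rw [HasFiniteIntegral]
  refine (lintegral_congr_ae ?_).trans_lt h
  filter_upwards [hm] with p hp
  rw [enorm_mul, ← ofReal_norm, Complex.norm_real, Real.norm_of_nonneg hp]

theorem HasLocallyFiniteMean.integrable_snd_mul {m : Measure (X × ℝ)}
    (hm : HasLocallyFiniteMean m) {w : X → ℂ} (hw : Measurable w) {C : ℝ} {K : Set X}
    (hK : IsCompact K) (hC : ∀ x, ‖w x‖ ≤ C) (hwK : ∀ x ∉ K, w x = 0) :
    Integrable (fun p : X × ℝ => p.2 * w p.1) m := by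
  refine integrable_snd_mul_of_lintegral_lt_top hm.ae_nonneg hw ?_
  calc ∫⁻ p, ENNReal.ofReal p.2 * ‖w p.1‖ₑ ∂m
      ≤ ∫⁻ p, ENNReal.ofReal C * (ENNReal.ofReal p.2 * K.indicator 1 p.1) ∂m := by
        refine lintegral_mono fun p => ?_
        rw [mul_left_comm]
        gcongr
        by_cases hp : p.1 ∈ K
        · simp only [hp, indicator_of_mem, Pi.one_apply, mul_one]
          rw [← ofReal_norm]
          exact ENNReal.ofReal_le_ofReal (hC _)
        · simp [hwK _ hp]
    _ = ENNReal.ofReal C * ∫⁻ p, ENNReal.ofReal p.2 * K.indicator 1 p.1 ∂m :=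
        lintegral_const_mul' _ _ ENNReal.ofReal_ne_top
    _ < ∞ := ENNReal.mul_lt_top ENNReal.ofReal_lt_top (hm.lintegral_lt_top K hK)

theorem IsCompoundPoisson.fourier {m : Measure (X × ℝ)} {μ : Measure (DiscreteRadon X)}
    (hμ : IsCompoundPoisson m μ) (hm : HasLocallyFiniteMean m) {f : X → ℝ} (hf : Measurable f)
    {C : ℝ} {K : Set X} (hK : IsCompact K) (hC : ∀ x, ‖f x‖ ≤ C) (hfK : ∀ x ∉ K, f x = 0) :
    Integrable (fun p : X × ℝ => Complex.exp (Complex.I * ((p.2 * f p.1 : ℝ) : ℂ)) - 1) m ∧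
    ∫ η : DiscreteRadon X, Complex.exp (Complex.I * ((∫ x, f x ∂η.1 : ℝ) : ℂ)) ∂μ =
      Complex.exp (∫ p : X × ℝ, (Complex.exp (Complex.I * ((p.2 * f p.1 : ℝ) : ℂ)) - 1) ∂m) := by
  have hw : Measurable fun x => Complex.I * (f x : ℂ) := by fun_prop
  have h1 : Integrable (fun p : X × ℝ => p.2 * (Complex.I * (f p.1 : ℂ))) m :=
    hm.integrable_snd_mul hw hK (C := C) (fun x => by simpa using hC x)
      fun x hx => by simp [hfK x hx]
  -- The exponent is purely imaginary, so the exponential moment condition is void.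
  have h2 : Integrable (fun p : X × ℝ =>
      Real.exp (max (p.2 * (Complex.I * (f p.1 : ℂ)).re) 0) - 1) m := by simp
  have h := (hμ.exp_functional _ hw h1 h2).2
  have e : ∀ p : X × ℝ, (p.2 : ℂ) * (Complex.I * (f p.1 : ℂ)) =
      Complex.I * ((p.2 * f p.1 : ℝ) : ℂ) := fun p => by push_cast; ring
  have h3 := integrable_exp_sub_one h1 (by simp)
  simp_rw [e, integral_const_mul, integral_complex_ofReal] at h h3
  exact ⟨h3, h⟩

/-- The Fourier formula holds for bounded measurable functions vanishing off a compact set, hence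
for the step functions `∑ t_i 1_{A_i}`. It then says that the joint characteristic function of the
`η(A_i)` is the product of the marginal ones. -/
theorem IsCompoundPoisson.isCompletelyRandom [T2Space X] [BorelSpace X] {m : Measure (X × ℝ)}
    {μ : Measure (DiscreteRadon X)}
    (hμ : IsCompoundPoisson m μ) (hm : HasLocallyFiniteMean m) : IsCompletelyRandom μ := by
  intro n A hA hAc hdisj
  have := hμ.isProbability
  have hfin : ∀ i (η : DiscreteRadon X), η.1 (A i) ≠ ∞ := fun i η =>
    ((measure_mono subset_closure).trans_lt (η.2.1 _ (hAc i))).ne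
  have hreal : ∀ i, Measurable fun η : DiscreteRadon X => η.1.real (A i) := fun i =>
    ((Measure.measurable_coe (hA i)).comp measurable_subtype_coe).ennreal_toReal
  suffices h : iIndepFun (fun i (η : DiscreteRadon X) => η.1.real (A i)) μ by
    have h' := h.comp (fun _ => ENNReal.ofReal) fun _ => ENNReal.measurable_ofReal
    convert h' with i η
    exact (ofReal_measureReal (hfin i η)).symm
  rw [iIndepFun_iff_charFun_pi fun i => (hreal i).aemeasurable]
  intro t
  set f : Fin n → X → ℝ := fun i => (A i).indicator fun _ => t i with hf
  have hfm : ∀ i, Measurable (f i) := fun i => measurable_const.indicator (hA i)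
  have hfi : ∀ i (η : DiscreteRadon X), Integrable (f i) η.1 := fun i η =>
    (integrable_indicator_iff (hA i)).2 (integrableOn_const (hfin i η))
  have hfint : ∀ i (η : DiscreteRadon X), ∫ x, f i x ∂η.1 = η.1.real (A i) * t i := by
    intro i η
    rw [hf]
    simp only
    rw [integral_indicator_const _ (hA i), smul_eq_mul]
  have hfb : ∀ i x, ‖f i x‖ ≤ |t i| := fun i x => norm_indicator_le_norm_self _ _
  have hf0 : ∀ i, ∀ x ∉ closure (A i), f i x = 0 := fun i x hx =>
    indicator_of_notMem (fun h => hx (subset_closure h)) _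
  have hS := hμ.fourier hm (f := fun x => ∑ i, f i x) (C := ∑ i, |t i|)
    (Finset.measurable_fun_sum _ fun i _ => hfm i) (isCompact_iUnion hAc)
    (fun x => (norm_sum_le _ _).trans (Finset.sum_le_sum fun i _ => hfb i x))
    (fun x hx => Finset.sum_eq_zero fun i _ => hf0 i x fun h => hx (mem_iUnion.2 ⟨i, h⟩))
  have h1 := fun i => hμ.fourier hm (hfm i) (hAc i) (hfb i) (hf0 i)
  have hvec : Measurable fun η : DiscreteRadon X => WithLp.toLp 2 fun i => η.1.real (A i) := by
    fun_prop
  have hL : charFun (μ.map fun η : DiscreteRadon X => WithLp.toLp 2 fun i => η.1.real (A i)) t =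
      ∫ η : DiscreteRadon X, Complex.exp (Complex.I * ((∫ x, ∑ i, f i x ∂η.1 : ℝ) : ℂ)) ∂μ := by
    rw [charFun_apply, integral_map hvec.aemeasurable (by fun_prop)]
    refine integral_congr_ae (ae_of_all _ fun η => ?_)
    simp only
    rw [mul_comm Complex.I, integral_finsetSum _ fun i _ => hfi i η, PiLp.inner_apply]
    simp_rw [hfint]
    simp [mul_comm]
  have hR : ∀ i, charFun (μ.map fun η : DiscreteRadon X => η.1.real (A i)) (t i) =
      ∫ η : DiscreteRadon X, Complex.exp (Complex.I * ((∫ x, f i x ∂η.1 : ℝ) : ℂ)) ∂μ := by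
    intro i
    rw [charFun_apply_real, integral_map (hreal i).aemeasurable (by fun_prop)]
    refine integral_congr_ae (ae_of_all _ fun η => ?_)
    simp only [hfint]
    push_cast
    ring_nf
  rw [hL, hS.2]
  simp_rw [hR, (h1 _).2]
  rw [← Complex.exp_sum, ← integral_finsetSum _ fun i _ => (h1 i).1]
  congr 1
  refine integral_congr_ae (ae_of_all _ fun p => ?_)
  simp only
  -- By disjointness at most one `f i` is nonzero at a given point, so `z ↦ e^z - 1` is additive on
  -- this sum.
  by_cases hp : ∃ i, p.1 ∈ A i
  · obtain ⟨i, hi⟩ := hp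
    have h0 : ∀ j, j ≠ i → f j p.1 = 0 := fun j hj =>
      indicator_of_notMem (fun h => (hdisj hj).le_bot ⟨h, hi⟩) _
    rw [Finset.sum_eq_single i (fun j _ hj => h0 j hj) (by simp),
      Finset.sum_eq_single i (fun j _ hj => by simp [h0 j hj]) (by simp)]
  · have h0 : ∀ j, f j p.1 = 0 := fun j => indicator_of_notMem (fun h => hp ⟨j, h⟩) _
    simp [h0]

theorem IsCompoundPoisson.isCompletelyRandomWithLevy [T2Space X] [BorelSpace X]
    {m : Measure (X × ℝ)} {μ : Measure (DiscreteRadon X)}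
    (hμ : IsCompoundPoisson m μ) (hm : HasLocallyFiniteMean m) :
    IsCompletelyRandomWithLevy m μ := by
  refine ⟨hμ.isProbability, hμ.isCompletelyRandom hm, fun f hf hfc => ?_⟩
  obtain ⟨C, hC⟩ := hfc.exists_bound_of_continuous hf
  exact (hμ.fourier hm hf.measurable hfc hC fun x hx => image_eq_zero_of_notMem_tsupport hx).2

end CompleteRandomness

-- One-dimensional gamma and Frullani integrals.

section GammaIntegrals

theorem integrableOn_exp_neg_div {a : ℝ} (ha : 0 < a) :
    IntegrableOn (fun s : ℝ => Real.exp (-s / a)) (Ioi 0) := by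
  have := integrableOn_exp_mul_Ioi (a := -(1 / a)) (by simpa using ha) 0
  refine this.congr (ae_of_all _ fun s => ?_)
  simp only
  congr 1
  ring

theorem integral_exp_neg_div {a : ℝ} (ha : 0 < a) :
    ∫ s in Ioi (0 : ℝ), Real.exp (-s / a) = a := by
  have := integral_exp_mul_Ioi (a := -(1 / a)) (by simpa using ha) 0
  rw [← integral_congr_ae (μ := volume.restrict (Ioi (0 : ℝ)))
    (ae_of_all _ fun s => show Real.exp (-(1 / a) * s) = Real.exp (-s / a) by congr 1; ring), this]
  simp

theorem lintegral_exp_neg_div {a : ℝ} (ha : 0 < a) :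
    ∫⁻ s in Ioi (0 : ℝ), ENNReal.ofReal (Real.exp (-s / a)) = ENNReal.ofReal a := by
  rw [← ofReal_integral_eq_lintegral_ofReal (integrableOn_exp_neg_div ha)
    (ae_of_all _ fun _ => (Real.exp_pos _).le), integral_exp_neg_div ha]

theorem integrableOn_frullani_exp {a b : ℝ} (ha : 0 < a) (hb : 0 < b) :
    IntegrableOn (fun s : ℝ => (Real.exp (-s / a) - Real.exp (-s / b)) / s) (Ioi 0) := by
  refine (((integrableOn_exp_neg_div ha).add (integrableOn_exp_neg_div hb)).const_mul
    |a⁻¹ - b⁻¹|).mono' (Measurable.aestronglyMeasurable (by fun_prop)) ?_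
  refine (ae_restrict_iff' measurableSet_Ioi).2 (ae_of_all _ fun s hs => ?_)
  have hs : 0 < s := hs
  rw [Real.norm_eq_abs, abs_div, abs_of_pos hs, div_le_iff₀ hs]
  -- The factor `|u - v|` is proportional to `s` and cancels the singularity `1 / s`.
  have key : ∀ u v : ℝ, |Real.exp u - Real.exp v| ≤ |u - v| * (Real.exp u + Real.exp v) := by
    intro u v
    wlog h : v ≤ u generalizing u v
    · rw [abs_sub_comm, abs_sub_comm u, add_comm]
      exact this v u (le_of_not_ge h)
    · rw [abs_of_nonneg (by simpa using h), abs_of_nonneg (by simpa using h)]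
      have h1 : Real.exp v = Real.exp u * Real.exp (v - u) := by rw [← Real.exp_add]; ring_nf
      have h2 := Real.add_one_le_exp (v - u)
      have h3 := Real.exp_pos u
      have h4 := Real.exp_pos v
      have h5 : Real.exp u * (v - u + 1) ≤ Real.exp v := by rw [h1]; gcongr
      nlinarith
  refine (key _ _).trans (le_of_eq ?_)
  have : |-s / a - -s / b| = |a⁻¹ - b⁻¹| * s := by
    rw [show -s / a - -s / b = -((a⁻¹ - b⁻¹) * s) by ring, abs_neg, abs_mul, abs_of_pos hs]
  rw [this]
  simp only [Pi.add_apply]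
  ring

theorem integral_frullani_exp {a b : ℝ} (ha : 0 < a) (hb : 0 < b) :
    ∫ s in Ioi (0 : ℝ), (Real.exp (-s / a) - Real.exp (-s / b)) / s = Real.log (a / b) := by
  have hc : Continuous fun x : ℝ => Real.exp (-x) := by fun_prop
  have e : ∀ s : ℝ, (Real.exp (-s / a) - Real.exp (-s / b)) / s =
      s⁻¹ • (Real.exp (-(a⁻¹ * s)) - Real.exp (-(b⁻¹ * s))) := by
    intro s
    rw [smul_eq_mul, div_eq_inv_mul, show -s / a = -(a⁻¹ * s) by ring,
      show -s / b = -(b⁻¹ * s) by ring]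
  have h := Frullani.integral_Ioi_eq (f := fun x : ℝ => Real.exp (-x)) (L := 1) (R := 0)
    (hc.locallyIntegrable.locallyIntegrableOn _) (inv_pos.2 ha) (inv_pos.2 hb)
    (by simpa using (hc.tendsto 0).mono_left nhdsWithin_le_nhds)
    (Real.tendsto_exp_atBot.comp tendsto_neg_atTop_atBot)
    (by simpa only [e] using integrableOn_frullani_exp ha hb)
  simp_rw [e]
  rw [h, sub_zero, smul_eq_mul, mul_one]
  congr 1
  field_simp

/-- The Lévy exponent of the gamma distribution under an exponential tilt. -/
theorem integral_gamma_tilt {a c u : ℝ} (ha : 0 < a) (hc : 0 < c) :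
    ∫ s in Ioi (0 : ℝ), (Real.exp (-s / a) / s) •
        (Complex.exp (s * (Complex.I * u + ((1 - c⁻¹) * a⁻¹ : ℝ))) - 1) =
      (∫ s in Ioi (0 : ℝ), (Real.exp (-s / a) / s) •
        (Complex.exp (Complex.I * ((s * (c * u) : ℝ) : ℂ)) - 1)) + Real.log c := by
  have hca : 0 < c * a := mul_pos hc ha
  -- The left integrand is `G s` plus the real difference `(e^{-s/(ca)} - e^{-s/a})/s`: tilting
  -- replaces the scale `a` by `c a`. The substitution `s ↦ c s` identifies `∫ G` with the integral
  -- on the right.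
  set G : ℝ → ℂ := fun s => (Real.exp (-s / (c * a)) / s) •
    (Complex.exp (Complex.I * ((s * u : ℝ) : ℂ)) - 1) with hG
  have hGi : IntegrableOn G (Ioi 0) := by
    refine ((integrableOn_exp_neg_div hca).const_mul |u|).mono'
      (Measurable.aestronglyMeasurable (by fun_prop)) ?_
    refine (ae_restrict_iff' measurableSet_Ioi).2 (ae_of_all _ fun s hs => ?_)
    have hs : 0 < s := hs
    rw [hG, norm_smul, Real.norm_of_nonneg (by positivity)]
    have h := Real.norm_exp_I_mul_ofReal_sub_one_le (x := s * u)
    calc _ ≤ Real.exp (-s / (c * a)) / s * ‖s * u‖ := by gcongr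
      _ = |u| * Real.exp (-s / (c * a)) := by
        rw [norm_mul, Real.norm_of_nonneg hs.le, Real.norm_eq_abs]
        field_simp
  have h1 : ∫ s in Ioi (0 : ℝ), (Real.exp (-s / a) / s) •
      (Complex.exp (Complex.I * ((s * (c * u) : ℝ) : ℂ)) - 1) = ∫ s in Ioi (0 : ℝ), G s := by
    have h := integral_comp_mul_left_Ioi G 0 hc
    rw [mul_zero, eq_inv_smul_iff₀ hc.ne', ← integral_smul] at h
    rw [← h]
    refine integral_congr_ae (ae_of_all _ fun s => ?_)
    simp only [hG, smul_smul]
    congr 1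
    · rw [show -(c * s) / (c * a) = -s / a by field_simp]
      field_simp
    · congr 3
      push_cast
      ring
  -- Frullani's integral with scales `c a` and `a`.
  have h2 : ((Real.log c : ℝ) : ℂ) =
      ∫ s in Ioi (0 : ℝ), (((Real.exp (-s / (c * a)) - Real.exp (-s / a)) / s : ℝ) : ℂ) := by
    rw [integral_complex_ofReal, integral_frullani_exp hca ha]
    congr 2
    field_simp
  have h3 : IntegrableOn (fun s : ℝ =>
      (((Real.exp (-s / (c * a)) - Real.exp (-s / a)) / s : ℝ) : ℂ)) (Ioi 0) :=
    (integrableOn_frullani_exp hca ha).ofReal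
  rw [h1, h2, ← integral_add hGi h3]
  refine setIntegral_congr_fun measurableSet_Ioi fun s hs => ?_
  have hs : s ≠ 0 := (show 0 < s from hs).ne'
  simp only [hG, Complex.real_smul]
  have e1 : Real.exp (-s / (c * a)) = Real.exp (-s / a) * Real.exp (s * ((1 - c⁻¹) * a⁻¹)) := by
    rw [← Real.exp_add]
    congr 1
    field_simp
    ring
  have e2 : Complex.exp (s * (Complex.I * u + ((1 - c⁻¹) * a⁻¹ : ℝ))) =
      Complex.exp (Complex.I * ((s * u : ℝ) : ℂ)) * ((Real.exp (s * ((1 - c⁻¹) * a⁻¹)) : ℝ) : ℂ) := by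
    rw [Complex.ofReal_exp, ← Complex.exp_add]
    congr 1
    push_cast
    ring
  rw [e1, e2]
  push_cast
  have hs' : (s : ℂ) ≠ 0 := by exact_mod_cast hs
  field_simp
  ring

end GammaIntegrals

-- Integration against the gamma Lévy measure.

section GammaLevyMeasure

variable {X : Type*} [MeasurableSpace X] {σ : Measure X} {α β : X → ℝ}

instance sFinite_gammaLevyMeasure [SFinite σ] : SFinite (gammaLevyMeasure σ α β) := by
  unfold gammaLevyMeasure; infer_instance

theorem ae_pos_gammaLevyMeasure : ∀ᵐ p ∂(gammaLevyMeasure σ α β), 0 < p.2 := by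
  refine (withDensity_absolutelyContinuous _ _).ae_le ?_
  refine Measure.ae_prod_mem_iff_ae_ae_mem (measurableSet_lt measurable_const measurable_snd) |>.2 ?_
  exact ae_of_all _ fun x => ae_restrict_mem measurableSet_Ioi

theorem lintegral_gammaLevyMeasure (hα : Measurable α) (hβ : Measurable β) {Ψ : X × ℝ → ℝ≥0∞}
    (hΨ : Measurable Ψ) :
    ∫⁻ p, Ψ p ∂(gammaLevyMeasure σ α β) =
      ∫⁻ x, (∫⁻ s in Ioi (0 : ℝ), ENNReal.ofReal (β x * Real.exp (-s / α x) / s) * Ψ (x, s)) ∂σ := by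
  have hd : Measurable fun p : X × ℝ =>
      ENNReal.ofReal (β p.1 * Real.exp (-p.2 / α p.1) / p.2) := by fun_prop
  rw [gammaLevyMeasure, lintegral_withDensity_eq_lintegral_mul _ hd hΨ,
    lintegral_prod _ (hd.mul hΨ).aemeasurable]
  rfl

theorem integral_gammaLevyMeasure [SFinite σ] (hα : Measurable α) (hβ : Measurable β) (hβ0 : ∀ x, 0 ≤ β x)
    {Ψ : X × ℝ → ℂ} (hΨ : Integrable Ψ (gammaLevyMeasure σ α β)) :
    Integrable (fun x => ∫ s in Ioi (0 : ℝ), (β x * Real.exp (-s / α x) / s) • Ψ (x, s)) σ ∧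
    ∫ p, Ψ p ∂(gammaLevyMeasure σ α β) =
      ∫ x, (∫ s in Ioi (0 : ℝ), (β x * Real.exp (-s / α x) / s) • Ψ (x, s)) ∂σ := by
  have hd : Measurable fun p : X × ℝ =>
      ENNReal.ofReal (β p.1 * Real.exp (-p.2 / α p.1) / p.2) := by fun_prop
  have hlt : ∀ᵐ p ∂(σ.prod (volume.restrict (Ioi (0 : ℝ)))),
      ENNReal.ofReal (β p.1 * Real.exp (-p.2 / α p.1) / p.2) < ∞ :=
    ae_of_all _ fun _ => ENNReal.ofReal_lt_top
  have e : ∀ x, ∫ s in Ioi (0 : ℝ), (β x * Real.exp (-s / α x) / s) • Ψ (x, s) =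
      ∫ s in Ioi (0 : ℝ), (ENNReal.ofReal (β x * Real.exp (-s / α x) / s)).toReal • Ψ (x, s) := by
    intro x
    refine setIntegral_congr_fun measurableSet_Ioi fun s hs => ?_
    have hs : 0 < s := hs
    rw [ENNReal.toReal_ofReal]
    have := hβ0 x
    positivity
  simp_rw [e]
  rw [gammaLevyMeasure, integrable_withDensity_iff_integrable_smul' hd hlt] at hΨ
  refine ⟨hΨ.integral_prod_left, ?_⟩
  rw [gammaLevyMeasure, integral_withDensity_eq_integral_toReal_smul hd hlt]
  exact integral_prod _ hΨ

/-- The mark `s` cancels the singularity `1 / s`, and `∫ e^{-s/α} ds = α`. -/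
theorem lintegral_snd_mul_gammaLevyMeasure (hα : Measurable α) (hβ : Measurable β)
    (hα0 : ∀ x, 0 < α x) (hβ0 : ∀ x, 0 ≤ β x) {φ : X → ℝ≥0∞} (hφ : Measurable φ) :
    ∫⁻ p, ENNReal.ofReal p.2 * φ p.1 ∂(gammaLevyMeasure σ α β) =
      ∫⁻ x, ENNReal.ofReal (α x * β x) * φ x ∂σ := by
  rw [lintegral_gammaLevyMeasure hα hβ (by fun_prop)]
  refine lintegral_congr fun x => ?_
  calc ∫⁻ s in Ioi (0 : ℝ), ENNReal.ofReal (β x * Real.exp (-s / α x) / s) *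
        (ENNReal.ofReal s * φ x)
      = ∫⁻ s in Ioi (0 : ℝ), ENNReal.ofReal (β x) * φ x * ENNReal.ofReal (Real.exp (-s / α x)) := by
        refine setLIntegral_congr_fun measurableSet_Ioi fun s hs => ?_
        have hs : 0 < s := hs
        have := hβ0 x
        rw [← mul_assoc, ← ENNReal.ofReal_mul (by positivity), div_mul_cancel₀ _ hs.ne',
          ENNReal.ofReal_mul (hβ0 x)]
        ring
    _ = ENNReal.ofReal (β x) * φ x * ENNReal.ofReal (α x) := by
        rw [lintegral_const_mul _ (by fun_prop), lintegral_exp_neg_div (hα0 x)]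
    _ = _ := by
        rw [ENNReal.ofReal_mul (hα0 x).le]
        ring

/-- Exponential moments of `gammaLevyMeasure` below the critical slope. -/
theorem integrable_exp_sub_one_gammaLevyMeasure (hα : Measurable α) (hβ : Measurable β)
    (hα0 : ∀ x, 0 < α x) (hβ0 : ∀ x, 0 ≤ β x) {g : X → ℝ} (hg : Measurable g) (hg0 : ∀ x, 0 ≤ g x)
    {c : ℝ} (hc : 0 < c) (hgc : ∀ x, g x ≤ (1 - c⁻¹) * (α x)⁻¹)
    (hint : ∫⁻ x, ENNReal.ofReal (α x * β x) * ENNReal.ofReal (g x) ∂σ < ∞) :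
    Integrable (fun p : X × ℝ => Real.exp (p.2 * g p.1) - 1) (gammaLevyMeasure σ α β) := by
  refine ⟨by fun_prop, ?_⟩
  rw [HasFiniteIntegral, lintegral_gammaLevyMeasure hα hβ (by fun_prop)]
  calc ∫⁻ x, (∫⁻ s in Ioi (0 : ℝ), ENNReal.ofReal (β x * Real.exp (-s / α x) / s) *
        ‖Real.exp (s * g x) - 1‖ₑ) ∂σ
      ≤ ∫⁻ x, (∫⁻ s in Ioi (0 : ℝ), ENNReal.ofReal (β x * g x) *
        ENNReal.ofReal (Real.exp (-s / (c * α x)))) ∂σ := by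
        refine lintegral_mono fun x => setLIntegral_mono (by fun_prop) fun s hs => ?_
        have hs : 0 < s := hs
        have hb := hβ0 x
        have ha := hα0 x
        have hgx := hg0 x
        have h0 : 0 ≤ s * g x := by positivity
        rw [Real.enorm_of_nonneg (by simpa using h0), ← ENNReal.ofReal_mul (by positivity),
          ← ENNReal.ofReal_mul (by positivity)]
        refine ENNReal.ofReal_le_ofReal ?_
        -- The factor `s` in this bound cancels `1 / s` in the density.
        have h1 : Real.exp (s * g x) - 1 ≤ s * g x * Real.exp (s * g x) := by
          have h2 := Real.add_one_le_exp (-(s * g x))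
          have h3 := Real.exp_pos (s * g x)
          have h4 : Real.exp (-(s * g x)) * Real.exp (s * g x) = 1 := by
            rw [← Real.exp_add]; simp
          nlinarith
        -- The slope of `g` stays below `1/α` by the margin `1/(c α)`, which leaves an exponential
        -- of mean `c α`.
        have h5 : Real.exp (-s / α x) * Real.exp (s * g x) ≤ Real.exp (-s / (c * α x)) := by
          rw [← Real.exp_add, Real.exp_le_exp]
          have h6 : s * g x ≤ s * ((1 - c⁻¹) * (α x)⁻¹) := by gcongr; exact hgc x
          have h7 : -s / α x + s * ((1 - c⁻¹) * (α x)⁻¹) = -s / (c * α x) := by field_simp; ring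
          linarith
        calc β x * Real.exp (-s / α x) / s * (Real.exp (s * g x) - 1)
            ≤ β x * Real.exp (-s / α x) / s * (s * g x * Real.exp (s * g x)) := by gcongr
          _ = β x * g x * (Real.exp (-s / α x) * Real.exp (s * g x)) := by field_simp
          _ ≤ _ := by gcongr
    _ = ∫⁻ x, ENNReal.ofReal c * (ENNReal.ofReal (α x * β x) * ENNReal.ofReal (g x)) ∂σ := by
        refine lintegral_congr fun x => ?_
        rw [lintegral_const_mul _ (by fun_prop), lintegral_exp_neg_div (mul_pos hc (hα0 x)),
          ENNReal.ofReal_mul (hβ0 x), ENNReal.ofReal_mul hc.le, ENNReal.ofReal_mul (hα0 x).le]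
        ring
    _ = ENNReal.ofReal c * ∫⁻ x, ENNReal.ofReal (α x * β x) * ENNReal.ofReal (g x) ∂σ :=
        lintegral_const_mul' _ _ ENNReal.ofReal_ne_top
    _ < ∞ := ENNReal.mul_lt_top ENNReal.ofReal_lt_top hint

end GammaLevyMeasure

-- Exponential tilting and quasi-invariance under currents.

section QuasiInvariance

variable {X : Type*} [TopologicalSpace X]

theorem Current.hasCompactSupport_comp [T2Space X] (θ : Current X) {u : ℝ → ℝ} (hu : u 1 = 0) :
    HasCompactSupport fun x => u (θ.toFun x) := by
  obtain ⟨C, hC, h⟩ := θ.eq_one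
  exact HasCompactSupport.intro hC fun x hx => by rw [h x hx, hu]

/-- The bound `c` provides the uniform margin for exponential moments; `1 ≤ c` makes `1 - c⁻¹`
nonnegative, so it also bounds the positive part of `1 - θ⁻¹`. -/
theorem Current.exists_le [T2Space X] (θ : Current X) : ∃ c : ℝ, 1 ≤ c ∧ ∀ x, θ.toFun x ≤ c := by
  obtain ⟨C, hC⟩ := (θ.hasCompactSupport_comp (u := fun t => t - 1) (by simp)).exists_bound_of_continuous
    (θ.continuous_toFun.sub continuous_const)
  refine ⟨1 + |C|, by simp, fun x => ?_⟩
  have h := (Real.le_norm_self _).trans ((hC x).trans (le_abs_self C))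
  linarith

variable [MeasurableSpace X] [BorelSpace X]

theorem Current.integral_mulMeasure (θ : Current X) (η : Measure X) (f : X → ℝ) :
    ∫ x, f x ∂(θ.mulMeasure η) = ∫ x, θ.toFun x * f x ∂η := by
  have hm : Measurable (fun x => ENNReal.ofReal (θ.toFun x)) :=
    θ.continuous_toFun.measurable.ennreal_ofReal
  rw [Current.mulMeasure, integral_withDensity_eq_integral_toReal_smul hm (ae_of_all _ fun _ => by simp)]
  refine integral_congr_ae (ae_of_all _ fun x => ?_)
  simp [ENNReal.toReal_ofReal (θ.pos x).le]

variable {σ : Measure X} {α β : X → ℝ}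

theorem hasLocallyFiniteMean_gammaLevyMeasure [T2Space X] (hα : Measurable α) (hβ : Measurable β)
    (hα0 : ∀ x, 0 < α x) (hβ0 : ∀ x, 0 ≤ β x)
    (hαβ : LocallyIntegrable (fun x => α x * β x) σ) :
    HasLocallyFiniteMean (gammaLevyMeasure σ α β) := by
  refine ⟨ae_pos_gammaLevyMeasure.mono fun _ h => h.le, fun K hK => ?_⟩
  rw [lintegral_snd_mul_gammaLevyMeasure hα hβ hα0 hβ0 (measurable_one.indicator hK.measurableSet)]
  have h : ∀ x, ENNReal.ofReal (α x * β x) * K.indicator 1 x =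
      K.indicator (fun x => ENNReal.ofReal (α x * β x)) x := fun x => by
    by_cases hx : x ∈ K <;> simp [hx]
  simp_rw [h]
  rw [lintegral_indicator hK.measurableSet]
  exact (hαβ.integrableOn_isCompact hK).lintegral_lt_top

/-- The exponent of the density of the tilted gamma measure. -/
def gammaTilt (α β : X → ℝ) (θ : Current X) : X → ℝ :=
  {x | 0 < β x}.indicator fun x => (1 - (θ.toFun x)⁻¹) * (α x)⁻¹

omit [TopologicalSpace X] [BorelSpace X] in
theorem measurableSet_pos (hβ : Measurable β) : MeasurableSet {x | 0 < β x} :=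
  measurableSet_lt measurable_const hβ

theorem measurable_gammaTilt (hα : Measurable α) (hβ : Measurable β) (θ : Current X) :
    Measurable (gammaTilt α β θ) := by
  have := θ.continuous_toFun.measurable
  exact Measurable.indicator (by fun_prop) (measurableSet_pos hβ)

/-- The factor `α` cancels, leaving `β |1 - θ⁻¹|`, a locally integrable function times a continuous
one with compact support. No lower bound on `α` is needed. -/
theorem lintegral_gammaTilt_lt_top [T2Space X] [LocallyCompactSpace X]
    (hα0 : ∀ x, 0 < α x) (hβ0 : ∀ x, 0 ≤ β x)
    (hβint : LocallyIntegrable β σ) (θ : Current X) :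
    ∫⁻ x, ENNReal.ofReal (α x * β x) * ‖gammaTilt α β θ x‖ₑ ∂σ < ∞ := by
  have hc : Continuous fun x => 1 - (θ.toFun x)⁻¹ :=
    continuous_const.sub (θ.continuous_toFun.inv₀ fun x => (θ.pos x).ne')
  have h := hβint.integrable_smul_left_of_hasCompactSupport hc
    (θ.hasCompactSupport_comp (u := fun t => 1 - t⁻¹) (by simp))
  refine (lintegral_congr fun x => ?_).trans_lt h.2
  have ha := hα0 x
  rcases (hβ0 x).lt_or_eq with hx | hx
  · rw [gammaTilt, indicator_of_mem (show x ∈ {x | 0 < β x} from hx),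
      ← Real.enorm_of_nonneg (mul_pos ha hx).le, ← enorm_mul]
    congr 1
    simp only [smul_eq_mul]
    field_simp
  · simp [← hx]

theorem integrable_log_mul [T2Space X] [LocallyCompactSpace X]
    (hβint : LocallyIntegrable β σ) (θ : Current X) :
    Integrable (fun x => Real.log (θ.toFun x) * β x) σ :=
  hβint.integrable_smul_left_of_hasCompactSupport
    (θ.continuous_toFun.log fun x => (θ.pos x).ne')
    (θ.hasCompactSupport_comp Real.log_one)

omit [BorelSpace X] in
theorem setIntegral_pos_log_mul (hβ0 : ∀ x, 0 ≤ β x) (θ : Current X) :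
    ∫ x in {x | 0 < β x}, Real.log (θ.toFun x) * β x ∂σ = ∫ x, Real.log (θ.toFun x) * β x ∂σ := by
  refine setIntegral_eq_integral_of_forall_compl_eq_zero fun x hx => ?_
  rw [le_antisymm (not_lt.1 hx) (hβ0 x), mul_zero]

section

variable [T2Space X] [LocallyCompactSpace X] [SFinite σ]
  (hα : Measurable α) (hβ : Measurable β) (hα0 : ∀ x, 0 < α x) (hβ0 : ∀ x, 0 ≤ β x)
  (hαβ : LocallyIntegrable (fun x => α x * β x) σ) (hβint : LocallyIntegrable β σ)

omit [SFinite σ] in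
include hα hβ hα0 hβ0 hβint in
-- By Campbell's formula the expectation of `∫ |g| dη` is the finite integral of `α β |g|`.
theorem ae_integrable_gammaTilt {μ : Measure (DiscreteRadon X)}
    (hμ : IsCompoundPoisson (gammaLevyMeasure σ α β) μ) (θ : Current X) :
    ∀ᵐ η : DiscreteRadon X ∂μ, Integrable (gammaTilt α β θ) η.1 := by
  have hg := measurable_gammaTilt hα hβ θ
  have h := hμ.campbell _ hg.enorm
  rw [lintegral_snd_mul_gammaLevyMeasure hα hβ hα0 hβ0 hg.enorm] at h
  have h2 := ae_lt_top ((Measure.measurable_lintegral hg.enorm).comp measurable_subtype_coe)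
    (h.trans_lt (lintegral_gammaTilt_lt_top hα0 hβ0 hβint θ)).ne
  filter_upwards [h2] with η hη
  exact ⟨hg.aestronglyMeasurable, hη⟩

include hα hβ hα0 hβ0 hαβ hβint in
/-- The Lévy exponent of the exponential functional with the tilt. -/
theorem exp_functional_gammaTilt {μ : Measure (DiscreteRadon X)}
    (hμ : IsCompoundPoisson (gammaLevyMeasure σ α β) μ) (θ : Current X) {f : X → ℝ}
    (hf : Continuous f) (hfc : HasCompactSupport f) :
    Integrable (fun η : DiscreteRadon X =>
      Complex.exp (∫ x, (Complex.I * f x + gammaTilt α β θ x) ∂η.1)) μ ∧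
    ∫ η : DiscreteRadon X, Complex.exp (∫ x, (Complex.I * f x + gammaTilt α β θ x) ∂η.1) ∂μ =
      Complex.exp ((∫ p : X × ℝ, (Complex.exp (Complex.I * ((p.2 * (θ.toFun p.1 * f p.1) : ℝ) : ℂ))
        - 1) ∂(gammaLevyMeasure σ α β)) + ((∫ x, Real.log (θ.toFun x) * β x ∂σ : ℝ) : ℂ)) := by
  have hg := measurable_gammaTilt hα hβ θ
  have hfm := hf.measurable
  have hmean := hasLocallyFiniteMean_gammaLevyMeasure (σ := σ) hα hβ hα0 hβ0 hαβ
  obtain ⟨C, hC⟩ := hfc.exists_bound_of_continuous hf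
  have h1 : Integrable (fun p : X × ℝ => p.2 * (Complex.I * (f p.1 : ℂ)))
      (gammaLevyMeasure σ α β) :=
    hmean.integrable_snd_mul (w := fun x => Complex.I * (f x : ℂ)) (by fun_prop) hfc (C := C)
      (fun x => by simpa using hC x)
      fun x hx => by simp [image_eq_zero_of_notMem_tsupport hx]
  have h2 : Integrable (fun p : X × ℝ => (p.2 : ℂ) * (gammaTilt α β θ p.1 : ℂ))
      (gammaLevyMeasure σ α β) := by
    refine integrable_snd_mul_of_lintegral_lt_top hmean.ae_nonneg
      (w := fun x => (gammaTilt α β θ x : ℂ)) (by fun_prop) ?_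
    have he : ∀ x, ‖((gammaTilt α β θ x : ℝ) : ℂ)‖ₑ = ‖gammaTilt α β θ x‖ₑ := fun x => by
      rw [← ofReal_norm, ← ofReal_norm, Complex.norm_real]
    simp_rw [he]
    rw [lintegral_snd_mul_gammaLevyMeasure hα hβ hα0 hβ0 hg.enorm]
    exact lintegral_gammaTilt_lt_top hα0 hβ0 hβint θ
  have h3 : Integrable (fun p : X × ℝ =>
      (p.2 : ℂ) * (Complex.I * (f p.1 : ℂ) + (gammaTilt α β θ p.1 : ℂ)))
      (gammaLevyMeasure σ α β) := by
    exact (h1.add h2).congr (ae_of_all _ fun p => by simp only [Pi.add_apply, mul_add])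
  have h4 : Integrable (fun p : X × ℝ => Real.exp (max (p.2 *
      (Complex.I * (f p.1 : ℂ) + (gammaTilt α β θ p.1 : ℂ)).re) 0) - 1)
      (gammaLevyMeasure σ α β) := by
    obtain ⟨c, hc1, hc⟩ := θ.exists_le
    have hc0 : 0 < c := by linarith
    have h5 := integrable_exp_sub_one_gammaLevyMeasure (σ := σ) hα hβ hα0 hβ0
      (g := fun x => max (gammaTilt α β θ x) 0) (hg.max measurable_const)
      (fun x => le_max_right _ _) hc0 (fun x => ?_) ?_
    · refine h5.congr ?_
      filter_upwards [hmean.ae_nonneg] with p hp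
      congr 2
      simp [mul_max_of_nonneg _ _ hp]
    · have hcinv : c⁻¹ ≤ 1 := inv_le_one_of_one_le₀ hc1
      have hainv := inv_pos.2 (hα0 x)
      refine max_le ?_ (mul_nonneg (by linarith) hainv.le)
      by_cases hx : 0 < β x
      · rw [gammaTilt, indicator_of_mem (show x ∈ {x | 0 < β x} from hx)]
        have := inv_anti₀ (θ.pos x) (hc x)
        gcongr
      · rw [gammaTilt, indicator_of_notMem (show x ∉ {x | 0 < β x} from hx)]
        exact mul_nonneg (by linarith) hainv.le
    · refine (lintegral_mono fun x => ?_).trans_lt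
        (lintegral_gammaTilt_lt_top (σ := σ) hα0 hβ0 hβint θ)
      gcongr
      rw [← ofReal_norm]
      exact ENNReal.ofReal_le_ofReal (max_le (Real.le_norm_self _) (norm_nonneg _))
  obtain ⟨h5, h6⟩ := hμ.exp_functional
    (fun x => Complex.I * (f x : ℂ) + (gammaTilt α β θ x : ℂ)) (by fun_prop) h3 h4
  refine ⟨h5, h6.trans ?_⟩
  congr 1
  -- The current enters through the test function `θ f`; integrability of its Fourier integrand
  -- allows the comparison fibre by fibre over `x`.
  obtain ⟨C', hC'⟩ := (hfc.mul_left (f := θ.toFun)).exists_bound_of_continuous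
    (θ.continuous_toFun.mul hf)
  have hθf := (hμ.fourier hmean (f := fun x => θ.toFun x * f x)
    (θ.continuous_toFun.mul hf).measurable hfc hC'
    fun x hx => by rw [image_eq_zero_of_notMem_tsupport hx, mul_zero]).1
  have h7 := integral_gammaLevyMeasure hα hβ hβ0 hθf
  have hlog : Integrable (fun x => ((Real.log (θ.toFun x) * β x : ℝ) : ℂ)) σ :=
    (integrable_log_mul hβint θ).ofReal
  rw [(integral_gammaLevyMeasure hα hβ hβ0 (integrable_exp_sub_one h3 (by simpa using h4))).2, h7.2,
    ← integral_complex_ofReal, ← integral_add h7.1 hlog]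
  refine integral_congr_ae (ae_of_all _ fun x => ?_)
  simp only
  rcases (hβ0 x).lt_or_eq with hx | hx
  · have h8 := integral_gamma_tilt (u := f x) (hα0 x) (θ.pos x)
    rw [gammaTilt, indicator_of_mem (show x ∈ {x | 0 < β x} from hx)]
    have e : ∀ (s : ℝ) (z : ℂ), (β x * Real.exp (-s / α x) / s) • z =
        (β x : ℂ) * ((Real.exp (-s / α x) / s) • z) := by
      intro s z
      simp only [Complex.real_smul]
      push_cast
      ring
    simp_rw [e, integral_const_mul]
    rw [h8]
    push_cast
    ring
  · simp [← hx]

include hα hβ hα0 hβ0 hαβ hβint in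
/-- The density of the image of the gamma measure under a current. -/
theorem map_act_eq_withDensity [SigmaCompactSpace X] [TopologicalSpace.PseudoMetrizableSpace X]
    {μ : Measure (DiscreteRadon X)}
    (hμ : IsCompoundPoisson (gammaLevyMeasure σ α β) μ) (θ : Current X) :
    μ.map θ.act = μ.withDensity fun η => ENNReal.ofReal (Real.exp
      ((∫ x, gammaTilt α β θ x ∂η.1) - ∫ x, Real.log (θ.toFun x) * β x ∂σ)) := by
  have := hμ.isProbability
  have hg := measurable_gammaTilt hα hβ θ
  set L : ℝ := ∫ x, Real.log (θ.toFun x) * β x ∂σ with hL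
  set D : DiscreteRadon X → ℝ := fun η => Real.exp ((∫ x, gammaTilt α β θ x ∂η.1) - L) with hD
  have hDm : Measurable D := Real.measurable_exp.comp
    ((stronglyMeasurable_integral_discreteRadon hg.stronglyMeasurable).measurable.sub_const L)
  -- Splitting the integral of `i f + g` requires `g ∈ L¹(η)`, so the identity holds only almost
  -- everywhere.
  have hexp : ∀ f : X → ℝ, Continuous f → HasCompactSupport f →
      (fun η : DiscreteRadon X => Complex.exp (-L) *
        Complex.exp (∫ x, (Complex.I * f x + gammaTilt α β θ x) ∂η.1)) =ᵐ[μ]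
      fun η => D η • Complex.exp (Complex.I * ((∫ x, f x ∂η.1 : ℝ) : ℂ)) := by
    intro f hf hfc
    filter_upwards [ae_integrable_gammaTilt hα hβ hα0 hβ0 hβint hμ θ] with η hη
    have h1 : Integrable (fun x => Complex.I * (f x : ℂ)) η.1 :=
      (hf.integrable_of_hasCompactSupport hfc).ofReal.const_mul _
    have h2 : Integrable (fun x => (gammaTilt α β θ x : ℂ)) η.1 := hη.ofReal
    rw [integral_add h1 h2, integral_const_mul, integral_complex_ofReal, integral_complex_ofReal,
      Complex.real_smul, hD, ← Complex.exp_add]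
    simp only
    rw [Complex.ofReal_exp, ← Complex.exp_add]
    congr 1
    push_cast
    ring
  -- The exponential functional at `f = 0`.
  have hDi : Integrable D μ := by
    have h1 := ((exp_functional_gammaTilt hα hβ hα0 hβ0 hαβ hβint hμ θ (f := fun _ => 0)
      continuous_const HasCompactSupport.zero).1.const_mul (Complex.exp (-L))).congr
      (hexp (fun _ => 0) continuous_const HasCompactSupport.zero)
    refine h1.norm.congr (ae_of_all _ fun η => ?_)
    simp only [integral_zero, Complex.ofReal_zero, mul_zero, Complex.exp_zero, norm_smul, norm_one,
      mul_one]
    exact Real.norm_of_nonneg (Real.exp_pos _).le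
  have : IsProbabilityMeasure (μ.map θ.act) :=
    Measure.isProbabilityMeasure_map θ.measurable_act.aemeasurable
  have : IsFiniteMeasure (μ.withDensity fun η => ENNReal.ofReal (D η)) :=
    isFiniteMeasure_withDensity_ofReal hDi.2
  refine ext_of_fourier fun f hf hfc => ?_
  have hmean := hasLocallyFiniteMean_gammaLevyMeasure (σ := σ) hα hβ hα0 hβ0 hαβ
  have hfint : Measurable fun η : DiscreteRadon X =>
      Complex.exp (Complex.I * ((∫ x, f x ∂η.1 : ℝ) : ℂ)) := by
    have := (stronglyMeasurable_integral_discreteRadon hf.measurable.stronglyMeasurable).measurable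
    fun_prop
  rw [integral_map θ.measurable_act.aemeasurable hfint.aestronglyMeasurable,
    integral_withDensity_eq_integral_toReal_smul hDm.ennreal_ofReal
      (ae_of_all _ fun _ => ENNReal.ofReal_lt_top)]
  have hl : ∀ η : DiscreteRadon X, ∫ x, f x ∂(θ.act η).1 = ∫ x, θ.toFun x * f x ∂η.1 :=
    fun η => θ.integral_mulMeasure η.1 f
  have hD0 : ∀ η, (ENNReal.ofReal (D η)).toReal = D η := fun η =>
    ENNReal.toReal_ofReal (Real.exp_pos _).le
  simp_rw [hl, hD0]
  rw [← integral_congr_ae (hexp f hf hfc), integral_const_mul,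
    (exp_functional_gammaTilt hα hβ hα0 hβ0 hαβ hβint hμ θ hf hfc).2,
    (hμ.isCompletelyRandomWithLevy hmean).fourier (fun x => θ.toFun x * f x)
      (θ.continuous_toFun.mul hf) hfc.mul_left, ← Complex.exp_add]
  congr 1
  ring

end

end QuasiInvariance

end

-- The main theorem.

theorem theorem3p7 {X : Type*} [TopologicalSpace X] [PolishSpace X] [LocallyCompactSpace X]
    [MeasurableSpace X] [BorelSpace X]
    (σ : Measure X) [IsFiniteMeasureOnCompacts σ] (hσ : ∀ x, σ {x} = 0)
    (α β : X → ℝ) (hα : Measurable α) (hβ : Measurable β)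
    (hα_pos : ∀ x, 0 < α x) (hβ_nonneg : ∀ x, 0 ≤ β x)
    (hαβ_int : LocallyIntegrable (fun x => α x * β x) σ) (hβ_int : LocallyIntegrable β σ) :
    (∃! μ : Measure (DiscreteRadon X),
      IsCompletelyRandomWithLevy (gammaLevyMeasure σ α β) μ) ∧
    ∀ μ : Measure (DiscreteRadon X), IsCompletelyRandomWithLevy (gammaLevyMeasure σ α β) μ →
      IsQuasiInvariant μ ∧
      ∀ θ : Current X,
        (∀ᵐ η : DiscreteRadon X ∂μ,
          IntegrableOn (fun x => (1 - (θ.toFun x)⁻¹) * (α x)⁻¹) {x | 0 < β x} η.1) ∧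
        IntegrableOn (fun x => Real.log (θ.toFun x) * β x) {x | 0 < β x} σ ∧
        (μ.map θ.act).rnDeriv μ =ᵐ[μ] fun η =>
          ENNReal.ofReal (Real.exp
            ((∫ x in {x | 0 < β x}, (1 - (θ.toFun x)⁻¹) * (α x)⁻¹ ∂η.1)
              - ∫ x in {x | 0 < β x}, Real.log (θ.toFun x) * β x ∂σ)) := by

  have : IsLocallyFiniteMeasure σ := isLocallyFiniteMeasure_of_isFiniteMeasureOnCompacts
  have hmean := hasLocallyFiniteMean_gammaLevyMeasure (σ := σ) hα hβ hα_pos hβ_nonneg hαβ_int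
  obtain ⟨μ₀, hμ₀⟩ := exists_isCompoundPoisson hmean
  have hμ₀L := hμ₀.isCompletelyRandomWithLevy hmean
  have huniq : ∀ μ : Measure (DiscreteRadon X),
      IsCompletelyRandomWithLevy (gammaLevyMeasure σ α β) μ → μ = μ₀ := by
    intro μ hμ
    have := hμ.isProbability
    have := hμ₀.isProbability
    exact ext_of_fourier fun f hf hfc => (hμ.fourier f hf hfc).trans (hμ₀L.fourier f hf hfc).symm
  refine ⟨⟨μ₀, hμ₀L, huniq⟩, fun μ hμ => ?_⟩
  -- Uniqueness transfers Campbell's formula and the full exponential functional, known for the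
  -- constructed measure, to an arbitrary `μ` with the given Fourier transform.
  obtain rfl := huniq μ hμ
  have := hμ₀.isProbability
  have hYm := measurableSet_pos hβ
  have hdens : ∀ θ : Current X, Measurable fun η : DiscreteRadon X => ENNReal.ofReal (Real.exp
      ((∫ x, gammaTilt α β θ x ∂η.1) - ∫ x, Real.log (θ.toFun x) * β x ∂σ)) := by
    intro θ
    have := (stronglyMeasurable_integral_discreteRadon
      (measurable_gammaTilt hα hβ θ).stronglyMeasurable).measurable
    fun_prop
  have hmap := map_act_eq_withDensity hα hβ hα_pos hβ_nonneg hαβ_int hβ_int hμ₀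
  refine ⟨fun θ => ?_, fun θ => ⟨?_, (integrable_log_mul hβ_int θ).integrableOn, ?_⟩⟩
  · rw [hmap θ]
    refine ⟨withDensity_absolutelyContinuous _ _,
      withDensity_absolutelyContinuous' (hdens θ).aemeasurable (ae_of_all _ fun η => ?_)⟩
    exact (ENNReal.ofReal_pos.2 (Real.exp_pos _)).ne'
  · filter_upwards [ae_integrable_gammaTilt hα hβ hα_pos hβ_nonneg hβ_int hμ₀ θ] with η hη
    exact (integrable_indicator_iff hYm).1 hη
  · rw [hmap θ]
    refine (Measure.rnDeriv_withDensity μ (hdens θ)).trans (ae_of_all _ fun η => ?_)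
    simp only
    rw [setIntegral_pos_log_mul hβ_nonneg θ, ← integral_indicator hYm]
    rfl
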